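/- Let $U[\mathbb{Z}]$ be the universal unital C*-algebra generated by unitaries $u^n$ ($n\in\mathbb{Z}$) and isometries $s_m$ ($m\in\mathbb{Z}\setminus\{0\}$) subject to $s_ms_n=s_{mn}$, $u^nu^m=u^{n+m}$, $s_mu^n=u^{mn}s_m$ and $\sum_{n\in\mathbb{Z}/(m)}u^ne_mu^{-n}=1$, where $e_m=s_ms_m^*$. Let $T=\{s_m^*u^ne_ku^{n'}s_{m'} : m,m',k\in\mathbb{Z}\setminus\{0\},\ n,n'\in\mathbb{Z}\}\cup\{0\}\subset U[\mathbb{Z}]$, which is an inverse semigroup under multiplication and $*$. For an inverse semigroup $S$ with zero and set of projections $E$, let $\hat E_0$ be the space of characters of $E$ (nonzero multiplicative maps $x:E\to\{0,1\}$ with $x(0)=0$, with the topology of pointwise convergence), and let $\hat E_{tight}$ be the closure in $\hat E_0$ of the set of characters with maximal support. For $s\in S$ and $x\in\hat E_0$ with $x(ss^*)=1$ put $(x.s)(e)=x(ses^*)$. The groupoid $\mathcal{G}$ consists of the germs $[(x,s)]$, $x(ss^*)=1$, where $(x,s)\sim(y,t)$ iff $x=y$ and $es=et$ for some $e\in E$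 with $x(e)=1$; the range of $[(x,s)]$ is $x$, its source is $x.s$, $[(x,s)][(x.s,t)]=[(x,st)]$, $[(x,s)]^{-1}=[(x.s,s^*)]$, and the sets $\{[(x,s)]:x\in U\}$, with $s\in S$ and $U\subset\{x : x(ss^*)=1\}$ open, form a basis of its topology. Exel's tight groupoid $\mathcal{G}_{tight}$ of $S$ is the reduction of $\mathcal{G}$ to $\hat E_{tight}$. Below, $\mathcal{G}_{tight}$ is the tight groupoid of $S=T$. Let $\hat{\mathbb{Z}}=\{(r_m)\in\prod_{m\ge1}\mathbb{Z}/(m) : r_{mk}\equiv r_m \bmod m\}$, and let $\mathcal{R}$ be the topological inductive limit of the copies $\mathcal{R}_m=\hat{\mathbb{Z}}$ ($m\geq 1$, ordered by divisibility) along the maps $\mathcal{R}_m\to\mathcal{R}_{\ell m}$ given by multiplication by $\ell$; regard $\hat{\mathbb{Z}}=\mathcal{R}_1\subset\mathcal{R}$. The discrete group $P_{\mathbb{Q}}=\left\{\begin{bmatrix}1&0\\ b&a\end{bmatrix}:a\in\mathbb{Q}^\times,\ b\in\mathbb{Q}\right\}$ acts on $\mathcal{R}$ by $\begin{bmatrix}1&0\\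 n/m'&m/m'\end{bmatrix}x=mx+np\in\mathcal{R}_{m'p}$ for $x\in\mathcal{R}_p$, $m'\ge 1$, and on the right by $x.g=g^{-1}x$. Let $\mathcal{R}\times P_{\mathbb{Q}}$ be the transformation groupoid, in which $(x,g)$ has range $x$ and source $x.g$, with $(x,g)(x.g,h)=(x,gh)$ and $(x,g)^{-1}=(x.g,g^{-1})$, and let $(\mathcal{R}\times P_{\mathbb{Q}})|_{\hat{\mathbb{Z}}}$ be its reduction to $\hat{\mathbb{Z}}$. For $r\in\hat{\mathbb{Z}}$ let $\xi_r$ be the character of the projections of $T$ with $\xi_r(u^ne_mu^{-n})=1$ if $r_m=n$ in $\mathbb{Z}/(m)$ and $\xi_r(u^ne_mu^{-n})=0$ otherwise ($m\ge1$, $n\in\mathbb{Z}$). Theorem. Both $(\mathcal{R}\times P_{\mathbb{Q}})|_{\hat{\mathbb{Z}}}$ and $\mathcal{G}_{tight}$ are topological groupoids, and there is a well-defined map $$\phi:(\mathcal{R}\times P_{\mathbb{Q}})|_{\hat{\mathbb{Z}}}\to\mathcal{G}_{tight},\qquad \phi\left(r,\begin{bmatrix}1&0\\ k/m&n/m\end{bmatrix}\right)=[(\xi_r,\,s_m^*u^ks_n)]\qquad(r\in\hat{\mathbb{Z}},\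 k,m,n\in\mathbb{Z},\ m,n\neq0),$$ which is an isomorphism of topological groupoids. -/

import Mathlib

open scoped nonZeroDivisors ENNReal

noncomputable section

namespace CuntzLi

set_option linter.unusedSectionVars false

/-! ## The Cuntz-Li relations over `ℤ` -/

/-- A family of unitaries `u n` (`n ∈ ℤ`) and isometries `s m` (`m ∈ ℤ`, `m ≠ 0`) in a unital
C*-algebra that satisfies the defining relations of `U[ℤ]`. In the last relation the sum over
`ℤ/(m)` runs over the representatives `0, …, |m| - 1`. -/
structure Family (A : Type*) [CStarAlgebra A] where
  u : ℤ → A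
  s : ℤ⁰ → A
  u_unitary : ∀ n, u n ∈ unitary A
  s_isometry : ∀ m, star (s m) * s m = 1
  s_mul : ∀ m n, s m * s n = s (m * n)
  u_mul : ∀ n m, u n * u m = u (n + m)
  s_mul_u : ∀ (m : ℤ⁰) (n : ℤ), s m * u n = u (m * n) * s m
  sum_eq_one : ∀ m : ℤ⁰, ∑ n ∈ Finset.range (m : ℤ).natAbs,
    u n * (s m * star (s m)) * u (-n) = 1

namespace Family

variable {A : Type*} [CStarAlgebra A] (F : Family A)

/-- The final projection `e_m = s_m s_m^*`. -/
def e (m : ℤ⁰) : A := F.s m * star (F.s m)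

/-- The set `P = {u^n e_m u^{-n}} ∪ {0}`. -/
def P : Set A := {x | ∃ (n : ℤ) (m : ℤ⁰), x = F.u n * F.e m * F.u (-n)} ∪ {0}

/-- The set `T = {s_m^* u^n e_k u^{n'} s_{m'}} ∪ {0}`. -/
def T : Set A :=
  {x | ∃ (m m' k : ℤ⁰) (n n' : ℤ), x = star (F.s m) * F.u n * F.e k * F.u n' * F.s m'} ∪ {0}

/-! ### `T` is an inverse semigroup -/

lemma u_zero : F.u 0 = 1 := by
  have h := F.u_mul 0 0
  have h1 := Unitary.star_mul_self_of_mem (F.u_unitary 0)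
  calc F.u 0 = (star (F.u 0) * F.u 0) * F.u 0 := by rw [h1, one_mul]
    _ = star (F.u 0) * F.u 0 := by rw [mul_assoc, h, add_zero]
    _ = 1 := h1

lemma star_u (n : ℤ) : star (F.u n) = F.u (-n) := by
  have h1 := Unitary.star_mul_self_of_mem (F.u_unitary n)
  calc star (F.u n) = star (F.u n) * (F.u n * F.u (-n)) := by
        rw [F.u_mul, add_neg_cancel, F.u_zero, mul_one]
    _ = F.u (-n) := by rw [← mul_assoc, h1, one_mul]

lemma u_neg_mul (n : ℤ) : F.u (-n) * F.u n = 1 := by rw [F.u_mul, neg_add_cancel, F.u_zero]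

lemma u_mul_neg (n : ℤ) : F.u n * F.u (-n) = 1 := by rw [F.u_mul, add_neg_cancel, F.u_zero]

lemma s_one : F.s 1 = 1 := by
  have h := F.s_mul 1 1
  rw [mul_one] at h
  calc F.s 1 = (star (F.s 1) * F.s 1) * F.s 1 := by rw [F.s_isometry, one_mul]
    _ = 1 := by rw [mul_assoc, h, F.s_isometry]

lemma e_one : F.e 1 = 1 := by simp [e, F.s_one]

lemma star_s_mul_u (m : ℤ⁰) (n : ℤ) : F.u n * star (F.s m) = star (F.s m) * F.u (m * n) := by
  have h := congrArg star (F.s_mul_u m (-n))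
  simpa [star_u] using h

/-- `p n m = u^n e_m u^{-n}`. -/
def p (n : ℤ) (m : ℤ⁰) : A := F.u n * F.e m * F.u (-n)

lemma s_u_s (m : ℤ⁰) (n : ℤ) : F.s m * F.u n * star (F.s m) = F.u (m * n) * F.e m := by
  rw [F.s_mul_u, e, mul_assoc]

lemma e_star (m : ℤ⁰) : star (F.e m) = F.e m := by simp [e]

lemma e_sq (m : ℤ⁰) : F.e m * F.e m = F.e m := by
  simp only [e]
  rw [mul_assoc, ← mul_assoc (star _), F.s_isometry, one_mul]

lemma s_e_s (m n : ℤ⁰) : F.s m * F.e n * star (F.s m) = F.e (m * n) := by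
  simp only [e, ← F.s_mul, star_mul, mul_assoc]

lemma conj_mul (m : ℤ⁰) (x y : A) : (F.s m * x * star (F.s m)) * (F.s m * y * star (F.s m)) =
    F.s m * (x * y) * star (F.s m) := by
  simp only [mul_assoc]
  rw [← mul_assoc (star (F.s m)) (F.s m), F.s_isometry, one_mul]

lemma uconj_mul (n : ℤ) (x y : A) : (F.u n * x * F.u (-n)) * (F.u n * y * F.u (-n)) =
    F.u n * (x * y) * F.u (-n) := by
  simp only [mul_assoc]
  rw [← mul_assoc (F.u (-n)) (F.u n), F.u_neg_mul, one_mul]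

lemma u_p_u (j n : ℤ) (m : ℤ⁰) : F.u j * F.p n m * F.u (-j) = F.p (j + n) m := by
  simp only [p, mul_assoc, F.u_mul]
  simp only [← mul_assoc, F.u_mul]
  rw [neg_add_rev]

lemma p_zero (m : ℤ⁰) : F.p 0 m = F.e m := by simp [p, F.u_zero]

lemma p_mul_zero (m : ℤ⁰) (j : ℤ) : F.p (m * j) m = F.e m := by
  have h : F.u (m * j) * F.e m = F.s m * F.u j * star (F.s m) := (F.s_u_s m j).symm
  rw [p, h, ← mul_neg, mul_assoc, ← F.star_s_mul_u, ← mul_assoc, mul_assoc (F.s m),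
    u_mul_neg, mul_one]
  rfl

lemma p_congr {n n' : ℤ} {m : ℤ⁰} (h : n ≡ n' [ZMOD m]) : F.p n m = F.p n' m := by
  obtain ⟨j, hj⟩ := h.dvd
  have : n' = n + m * j := by rw [← hj]; ring
  rw [this, ← F.u_p_u n (m * j), p_mul_zero, ← p_zero, u_p_u, add_zero]

lemma p_star (n : ℤ) (m : ℤ⁰) : star (F.p n m) = F.p n m := by
  simp [p, star_u, e_star, mul_assoc]

lemma p_sq (n : ℤ) (m : ℤ⁰) : F.p n m * F.p n m = F.p n m := by
  rw [p, uconj_mul, e_sq]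

lemma p_orth_range (m : ℤ⁰) {i j : ℕ} (hi : i ∈ Finset.range (m : ℤ).natAbs)
    (hj : j ∈ Finset.range (m : ℤ).natAbs) (hij : i ≠ j) : F.p i m * F.p j m = 0 := by
  let _ := CStarAlgebra.spectralOrder A
  have _ := CStarAlgebra.spectralOrderedRing A
  set R := Finset.range (m : ℤ).natAbs
  have key (k : ℕ) : F.p j m * F.p k m * F.p j m = star (F.p k m * F.p j m) * (F.p k m * F.p j m) := by
    rw [star_mul, p_star, p_star, mul_assoc, mul_assoc, ← mul_assoc (F.p k m) (F.p k m), p_sq]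
  have h1 : ∑ k ∈ R, F.p j m * F.p k m * F.p j m = F.p j m := by
    rw [← Finset.sum_mul, ← Finset.mul_sum]
    have := F.sum_eq_one m
    change ∑ k ∈ R, F.p k m = 1 at this
    rw [this, mul_one, p_sq]
  rw [← Finset.add_sum_erase _ _ hj, p_sq, p_sq] at h1
  have h2 := add_eq_left.mp h1
  rw [Finset.sum_eq_zero_iff_of_nonneg] at h2
  · have := h2 i (Finset.mem_erase.mpr ⟨hij, hi⟩)
    rw [key, CStarRing.star_mul_self_eq_zero_iff] at this
    exact this
  · intro k _
    rw [key]
    exact star_mul_self_nonneg _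

lemma p_orth (m : ℤ⁰) {i j : ℤ} (hij : ¬ i ≡ j [ZMOD m]) : F.p i m * F.p j m = 0 := by
  have hm : (m : ℤ) ≠ 0 := nonZeroDivisors.coe_ne_zero m
  have red (i : ℤ) : ∃ k : ℕ, k ∈ Finset.range (m : ℤ).natAbs ∧ i ≡ k [ZMOD m] := by
    refine ⟨(i % m).toNat, ?_, ?_⟩
    · rw [Finset.mem_range, ← Int.ofNat_lt, Int.toNat_of_nonneg (Int.emod_nonneg i hm),
        Int.natCast_natAbs]
      exact Int.emod_lt_abs i hm
    · rw [Int.toNat_of_nonneg (Int.emod_nonneg i hm)]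
      exact (Int.mod_modEq i m).symm
  obtain ⟨a, ha, ha'⟩ := red i
  obtain ⟨b, hb, hb'⟩ := red j
  rw [F.p_congr ha', F.p_congr hb']
  refine F.p_orth_range m ha hb ?_
  rintro rfl
  exact hij (ha'.trans hb'.symm)

lemma e_mul_e_left (d a : ℤ⁰) : F.e (d * a) * F.e d = F.e (d * a) := by
  have h : F.e d = F.s d * 1 * star (F.s d) := by simp [e]
  rw [← s_e_s, h, conj_mul, mul_one]

lemma p_mul_p_left (n : ℤ) (d a : ℤ⁰) : F.p n (d * a) * F.p n d = F.p n (d * a) := by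
  rw [p, p, uconj_mul, e_mul_e_left]

lemma e_decomp (a b : ℤ⁰) :
    F.e a = ∑ i ∈ Finset.range (b : ℤ).natAbs, F.p (a * i) (a * b) := by
  have h : F.e a = F.s a * 1 * star (F.s a) := by simp [e]
  rw [h, ← F.sum_eq_one b, Finset.mul_sum, Finset.sum_mul]
  refine Finset.sum_congr rfl fun i _ => ?_
  change F.s a * (F.u i * F.e b * F.u (-i)) * star (F.s a) = _
  rw [p, ← s_e_s]
  simp only [mul_assoc]
  rw [star_s_mul_u, ← mul_assoc, s_mul_u, mul_neg]
  simp only [mul_assoc]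

lemma e_mul_e_coprime {a b : ℤ⁰} (h : IsCoprime (a : ℤ) b) : F.e a * F.e b = F.e (a * b) := by
  have hb : (b : ℤ) ≠ 0 := nonZeroDivisors.coe_ne_zero b
  rw [F.e_decomp a b, Finset.sum_mul, Finset.sum_eq_single 0]
  · simp only [Nat.cast_zero, mul_zero, p_zero]
    rw [mul_comm a b, e_mul_e_left]
  · intro i hi hi0
    rw [mul_comm a b, ← p_mul_p_left, mul_assoc, ← F.p_zero b, p_orth, mul_zero]
    intro h0
    have h1 : (b : ℤ) ∣ a * i := (Int.modEq_zero_iff_dvd).1 h0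
    have h2 : (b : ℤ) ∣ i := h.symm.dvd_of_dvd_mul_left h1
    have h3 := Int.natAbs_dvd_natAbs.mpr h2
    rw [Finset.mem_range] at hi
    exact absurd (Nat.le_of_dvd (Nat.pos_of_ne_zero hi0) h3) (by simpa using hi)
  · intro h0
    exact absurd (Finset.mem_range.mpr (Int.natAbs_pos.mpr hb)) h0

lemma exists_gcd (m n : ℤ⁰) : ∃ d a b : ℤ⁰, m = d * a ∧ n = d * b ∧ IsCoprime (a : ℤ) b := by
  have hm : (m : ℤ) ≠ 0 := nonZeroDivisors.coe_ne_zero m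
  have hn : (n : ℤ) ≠ 0 := nonZeroDivisors.coe_ne_zero n
  have hg : 0 < Int.gcd (m : ℤ) n := Int.gcd_pos_of_ne_zero_left _ hm
  obtain ⟨a, b, hab, ha, hb⟩ := Int.exists_gcd_one hg
  refine ⟨⟨Int.gcd (m : ℤ) n, mem_nonZeroDivisors_of_ne_zero (by exact_mod_cast hg.ne')⟩,
    ⟨a, mem_nonZeroDivisors_of_ne_zero ?_⟩, ⟨b, mem_nonZeroDivisors_of_ne_zero ?_⟩,
    Subtype.ext ?_, Subtype.ext ?_, Int.isCoprime_iff_gcd_eq_one.2 hab⟩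
  · rintro rfl; exact hm (by rw [ha, zero_mul])
  · rintro rfl; exact hn (by rw [hb, zero_mul])
  · rw [Submonoid.coe_mul, mul_comm]; exact ha
  · rw [Submonoid.coe_mul, mul_comm]; exact hb

lemma mul_mem_P {x y : A} (hx : x ∈ F.P) (hy : y ∈ F.P) : x * y ∈ F.P := by
  rcases hx with ⟨r, m, rfl⟩ | hx
  swap
  · rw [Set.mem_singleton_iff.mp hx, zero_mul]; exact Or.inr rfl
  rcases hy with ⟨t, n, rfl⟩ | hy
  swap
  · rw [Set.mem_singleton_iff.mp hy, mul_zero]; exact Or.inr rfl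
  change F.p r m * F.p t n ∈ F.P
  obtain ⟨d, a, b, rfl, rfl, hab⟩ := exists_gcd m n
  by_cases h : r ≡ t [ZMOD d]
  · obtain ⟨j, hj⟩ := h.dvd
    obtain ⟨x, y, hxy⟩ := hab
    have h1 : r ≡ r + d * a * (x * j) [ZMOD (d * a : ℤ⁰)] :=
      (Int.modEq_iff_dvd).2 ⟨x * j, by push_cast; ring⟩
    have h2 : t ≡ r + d * a * (x * j) [ZMOD (d * b : ℤ⁰)] := by
      refine (Int.modEq_iff_dvd).2 ⟨- (y * j), ?_⟩
      push_cast
      have : t = r + d * j := by rw [← hj]; ring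
      rw [this]
      linear_combination (d * j : ℤ) * hxy
    refine Or.inl ⟨r + d * a * (x * j), d * (a * b), ?_⟩
    rw [F.p_congr h1, F.p_congr h2, p, p, uconj_mul, ← s_e_s, ← s_e_s F d b, conj_mul,
      F.e_mul_e_coprime ⟨x, y, hxy⟩, s_e_s]
  · right
    have h1 : F.p t d * F.p t (d * b) = F.p t (d * b) := by
      have := congrArg star (F.p_mul_p_left t d b)
      simpa [p_star] using this
    rw [← p_mul_p_left, ← h1, mul_assoc, ← mul_assoc (F.p r d), p_orth _ _ h, zero_mul, mul_zero]
    rfl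

lemma star_of_mem_P {x : A} (hx : x ∈ F.P) : star x = x := by
  rcases hx with ⟨r, m, rfl⟩ | hx
  · exact F.p_star r m
  · rw [Set.mem_singleton_iff.mp hx, star_zero]

lemma sq_of_mem_P {x : A} (hx : x ∈ F.P) : x * x = x := by
  rcases hx with ⟨r, m, rfl⟩ | hx
  · exact F.p_sq r m
  · rw [Set.mem_singleton_iff.mp hx, zero_mul]

lemma comm_of_mem_P {x y : A} (hx : x ∈ F.P) (hy : y ∈ F.P) : x * y = y * x := by
  have := F.star_of_mem_P (F.mul_mem_P hx hy)
  rw [star_mul, F.star_of_mem_P hx, F.star_of_mem_P hy] at this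
  exact this.symm

lemma e_mem_P (m : ℤ⁰) : F.e m ∈ F.P := Or.inl ⟨0, m, (F.p_zero m).symm⟩

lemma u_conj_mem_P (j : ℤ) {x : A} (hx : x ∈ F.P) : F.u j * x * F.u (-j) ∈ F.P := by
  rcases hx with ⟨r, m, rfl⟩ | hx
  · exact Or.inl ⟨j + r, m, F.u_p_u j r m⟩
  · rw [Set.mem_singleton_iff.mp hx, mul_zero, zero_mul]; exact Or.inr rfl

lemma s_conj_mem_P (m : ℤ⁰) {x : A} (hx : x ∈ F.P) : F.s m * x * star (F.s m) ∈ F.P := by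
  rcases hx with ⟨r, n, rfl⟩ | hx
  · refine Or.inl ⟨m * r, m * n, ?_⟩
    rw [← s_e_s, ← mul_neg]
    simp only [mul_assoc]
    rw [star_s_mul_u, ← mul_assoc, s_mul_u]
    simp only [mul_assoc]
  · rw [Set.mem_singleton_iff.mp hx, mul_zero, zero_mul]; exact Or.inr rfl

lemma star_s_conj_mem_P (m : ℤ⁰) {x : A} (hx : x ∈ F.P) : star (F.s m) * x * F.s m ∈ F.P := by
  rcases hx with ⟨k, n, rfl⟩ | hx
  swap
  · rw [Set.mem_singleton_iff.mp hx, mul_zero, zero_mul]; exact Or.inr rfl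
  change star (F.s m) * F.p k n * F.s m ∈ F.P
  have hs : F.e m * F.s m = F.s m := by rw [e, mul_assoc, F.s_isometry, mul_one]
  have hs' : star (F.s m) * F.e m = star (F.s m) := by rw [e, ← mul_assoc, F.s_isometry, one_mul]
  have hP : F.e m * F.p k n ∈ F.P := F.mul_mem_P (F.e_mem_P m) (Or.inl ⟨k, n, rfl⟩)
  obtain ⟨d, a, b, rfl, rfl, hab⟩ := exists_gcd m n
  by_cases h : k ≡ 0 [ZMOD d]
  · obtain ⟨j, hj⟩ := (Int.modEq_zero_iff_dvd).1 h
    obtain ⟨x, y, hxy⟩ := hab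
    have h1 : k ≡ (d * a : ℤ⁰) * (x * j) [ZMOD (d * b : ℤ⁰)] := by
      refine (Int.modEq_iff_dvd).2 ⟨- (y * j), ?_⟩
      push_cast
      rw [hj]
      linear_combination (d * j : ℤ) * hxy
    refine Or.inl ⟨x * j, b, ?_⟩
    have h2 : star (F.s a) * F.e b * F.s a = F.e b := by
      have ha : star (F.s a) * F.e a = star (F.s a) := by
        rw [e, ← mul_assoc, F.s_isometry, one_mul]
      rw [← ha, mul_assoc (star _), F.e_mul_e_coprime ⟨x, y, hxy⟩, ← s_e_s]
      simp only [mul_assoc, F.s_isometry, mul_one]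
      rw [← mul_assoc, F.s_isometry, one_mul]
    have h3 : star (F.s (d * a)) * F.e (d * b) * F.s (d * a) = F.e b := by
      rw [← s_e_s, ← s_mul, star_mul]
      simp only [mul_assoc]
      rw [← mul_assoc (star (F.s d)) (F.s d) (F.s a), F.s_isometry, one_mul,
        ← mul_assoc (star (F.s d)) (F.s d), F.s_isometry, one_mul, ← mul_assoc, h2]
    rw [F.p_congr h1, p, ← h3]
    simp only [mul_assoc]
    rw [← mul_assoc (star _) (F.u _), ← star_s_mul_u, ← mul_neg, ← s_mul_u]
    simp only [mul_assoc]
  · right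
    have h0 : F.e (d * a) * F.p k (d * b) = 0 := by
      have h1 : F.p k d * F.p k (d * b) = F.p k (d * b) := by
        have := congrArg star (F.p_mul_p_left k d b)
        simpa [p_star] using this
      rw [← e_mul_e_left, ← h1, mul_assoc, ← mul_assoc (F.e d), ← p_zero F d, p_orth, zero_mul,
        mul_zero]
      exact fun h' => h h'.symm
    rw [← hs', mul_assoc (star _), h0, mul_zero, zero_mul]
    rfl

lemma mem_T_iff {x : A} : x ∈ F.T ↔
    ∃ (m m' : ℤ⁰) (q : A) (j : ℤ), q ∈ F.P ∧ x = star (F.s m) * q * F.u j * F.s m' := by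
  constructor
  · rintro (⟨m, m', k, n, n', rfl⟩ | hx)
    · refine ⟨m, m', F.p n k, n + n', Or.inl ⟨n, k, rfl⟩, ?_⟩
      simp only [p, mul_assoc]
      rw [← mul_assoc (F.u (-n)), u_mul, neg_add_cancel_left]
    · refine ⟨1, 1, 0, 0, Or.inr rfl, ?_⟩
      rw [Set.mem_singleton_iff.mp hx]; simp
  · rintro ⟨m, m', q, j, ⟨n, k, rfl⟩ | hq, rfl⟩
    · refine Or.inl ⟨m, m', k, n, -n + j, ?_⟩
      rw [← u_mul]
      simp only [mul_assoc]
    · right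
      rw [Set.mem_singleton_iff.mp hq]; simp

lemma mul_mem_T {x y : A} (hx : x ∈ F.T) (hy : y ∈ F.T) : x * y ∈ F.T := by
  obtain ⟨m, m', q, j, hq, rfl⟩ := F.mem_T_iff.1 hx
  obtain ⟨k, k', q', l, hq', rfl⟩ := F.mem_T_iff.1 hy
  refine F.mem_T_iff.2 ⟨m * k, k' * m', (F.s k * q * star (F.s k)) *
    (F.u (k * j) * ((F.s k * F.e m' * star (F.s k)) * (F.s m' * q' * star (F.s m'))) *
      F.u (-(k * j))), k * j + m' * l, ?_, ?_⟩
  · exact F.mul_mem_P (F.s_conj_mem_P k hq) (F.u_conj_mem_P _ (F.mul_mem_P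
      (F.s_conj_mem_P k (F.e_mem_P m')) (F.s_conj_mem_P m' hq')))
  · have c1 : F.s m' * star (F.s k) = F.e m' * star (F.s k) * F.s m' := by
      have h : star (F.s m') * star (F.s k) = star (F.s k) * star (F.s m') := by
        rw [← star_mul, ← star_mul, s_mul, s_mul, mul_comm]
      rw [e, mul_assoc (F.s m'), h, mul_assoc, mul_assoc, F.s_isometry, mul_one]
    have hk (x : A) : star (F.s k) * (F.s k * x) = x := by
      rw [← mul_assoc, F.s_isometry, one_mul]
    have hm (x : A) : star (F.s m') * (F.s m' * x) = x := by
      rw [← mul_assoc, F.s_isometry, one_mul]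
    have hu (x : A) : F.u (-(k * j)) * (F.u (k * j + m' * l) * x) = F.u (m' * l) * x := by
      rw [← mul_assoc, u_mul, neg_add_cancel_left]
    have hsu (x : A) : star (F.s k) * (F.u (k * j) * (F.s k * x)) = F.u j * x := by
      rw [← mul_assoc, ← star_s_mul_u, mul_assoc, hk]
    have hsu' (x : A) : F.u (m' * l) * (F.s m' * x) = F.s m' * (F.u l * x) := by
      rw [← mul_assoc, ← s_mul_u, mul_assoc]
    calc _ = star (F.s m) * q * F.u j * (F.s m' * star (F.s k)) * q' * F.u l * F.s k' := by
          simp only [mul_assoc]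
      _ = _ := by
          rw [c1, mul_comm k' m', ← s_mul, ← s_mul, star_mul]
          have h : star (F.s m) * star (F.s k) = star (F.s k) * star (F.s m) := by
            rw [← star_mul, ← star_mul, s_mul, s_mul, mul_comm]
          rw [← h]
          simp only [mul_assoc, hk, hu, hsu, hsu', hm]

lemma star_mem_T {x : A} (hx : x ∈ F.T) : star x ∈ F.T := by
  rcases hx with ⟨m, m', k, n, n', rfl⟩ | hx
  · refine Or.inl ⟨m', m, k, -n', -n, ?_⟩
    simp [star_u, e_star, mul_assoc]
  · rw [Set.mem_singleton_iff.mp hx, star_zero]; exact Or.inr rfl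

lemma mul_star_mem_P {x : A} (hx : x ∈ F.T) : x * star x ∈ F.P := by
  obtain ⟨m, m', q, j, hq, rfl⟩ := F.mem_T_iff.1 hx
  have : star (F.s m) * q * F.u j * F.s m' * star (star (F.s m) * q * F.u j * F.s m') =
      star (F.s m) * (q * (F.u j * F.e m' * F.u (-j)) * q) * F.s m := by
    simp [star_u, F.star_of_mem_P hq, e, mul_assoc]
  rw [this]
  exact F.star_s_conj_mem_P m (F.mul_mem_P (F.mul_mem_P hq (F.u_conj_mem_P j (F.e_mem_P m'))) hq)

lemma mul_star_mul {x : A} (hx : x ∈ F.T) : x * star x * x = x := by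
  have h := F.sq_of_mem_P (F.mul_star_mem_P hx)
  have h0 : (x * star x * x - x) * star (x * star x * x - x) = 0 := by
    have e1 : x * star x * x * star x = x * star x := by rw [mul_assoc, h]
    simp only [star_sub, star_mul, star_star, sub_mul, mul_sub, ← mul_assoc, e1]
    simp
  exact sub_eq_zero.1 ((CStarRing.mul_star_self_eq_zero_iff _).1 h0)

end Family
/-! ## Groupoids given by their arrows -/

/-- A groupoid with unit space `X` and set of arrows `G`, with range map `rng` and source map
`src`; the product `a b` is defined when `src a = rng b`. -/
structure ArrowGroupoid (X G : Type*) where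
  rng : G → X
  src : G → X
  unit : X → G
  mul : ∀ a b : G, src a = rng b → G
  inv : G → G
  rng_unit : ∀ x, rng (unit x) = x
  src_unit : ∀ x, src (unit x) = x
  rng_mul : ∀ a b h, rng (mul a b h) = rng a
  src_mul : ∀ a b h, src (mul a b h) = src b
  rng_inv : ∀ a, rng (inv a) = src a
  src_inv : ∀ a, src (inv a) = rng a
  mul_assoc : ∀ (a b c : G) (h : src a = rng b) (h' : src b = rng c),
    mul (mul a b h) c ((src_mul a b h).trans h') = mul a (mul b c h') (h.trans (rng_mul b c h').symm)
  unit_mul : ∀ a, mul (unit (rng a)) a (src_unit _) = a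
  mul_unit : ∀ a, mul a (unit (src a)) (rng_unit _).symm = a
  mul_inv : ∀ a, mul a (inv a) (rng_inv a).symm = unit (rng a)
  inv_mul : ∀ a, mul (inv a) a (src_inv a) = unit (src a)

namespace ArrowGroupoid

variable {X G Y H : Type*}

/-- The reduction of a groupoid to a subset `Y` of its unit space: all arrows with range and
source in `Y`. -/
def restrict (𝒢 : ArrowGroupoid X G) (Y : Set X) :
    ArrowGroupoid Y {a : G // 𝒢.rng a ∈ Y ∧ 𝒢.src a ∈ Y} where
  rng a := ⟨𝒢.rng a, a.2.1⟩
  src a := ⟨𝒢.src a, a.2.2⟩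
  unit x := ⟨𝒢.unit x, by rw [𝒢.rng_unit]; exact x.2, by rw [𝒢.src_unit]; exact x.2⟩
  mul a b h := ⟨𝒢.mul a b (congrArg Subtype.val h), by rw [𝒢.rng_mul]; exact a.2.1,
    by rw [𝒢.src_mul]; exact b.2.2⟩
  inv a := ⟨𝒢.inv a, by rw [𝒢.rng_inv]; exact a.2.2, by rw [𝒢.src_inv]; exact a.2.1⟩
  rng_unit x := Subtype.ext (𝒢.rng_unit _)
  src_unit x := Subtype.ext (𝒢.src_unit _)
  rng_mul _ _ _ := Subtype.ext (𝒢.rng_mul _ _ _)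
  src_mul _ _ _ := Subtype.ext (𝒢.src_mul _ _ _)
  rng_inv _ := Subtype.ext (𝒢.rng_inv _)
  src_inv _ := Subtype.ext (𝒢.src_inv _)
  mul_assoc _ _ _ _ _ := Subtype.ext (𝒢.mul_assoc _ _ _ _ _)
  unit_mul _ := Subtype.ext (𝒢.unit_mul _)
  mul_unit _ := Subtype.ext (𝒢.mul_unit _)
  mul_inv _ := Subtype.ext (𝒢.mul_inv _)
  inv_mul _ := Subtype.ext (𝒢.inv_mul _)

/-- All structure maps of the groupoid are continuous. -/
structure IsTopological [TopologicalSpace X] [TopologicalSpace G] (𝒢 : ArrowGroupoid X G) :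
    Prop where
  continuous_rng : Continuous 𝒢.rng
  continuous_src : Continuous 𝒢.src
  continuous_unit : Continuous 𝒢.unit
  continuous_inv : Continuous 𝒢.inv
  continuous_mul : Continuous fun c : {c : G × G // 𝒢.src c.1 = 𝒢.rng c.2} =>
    𝒢.mul c.1.1 c.1.2 c.2

/-- An isomorphism of groupoids that is a homeomorphism on arrows and on units. -/
structure TopIso [TopologicalSpace X] [TopologicalSpace G] [TopologicalSpace Y]
    [TopologicalSpace H] (𝒢 : ArrowGroupoid X G) (ℋ : ArrowGroupoid Y H) where
  arrows : G ≃ₜ H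
  units : X ≃ₜ Y
  map_rng : ∀ a, ℋ.rng (arrows a) = units (𝒢.rng a)
  map_src : ∀ a, ℋ.src (arrows a) = units (𝒢.src a)
  map_unit : ∀ x, arrows (𝒢.unit x) = ℋ.unit (units x)
  map_mul : ∀ a b (h : 𝒢.src a = 𝒢.rng b), arrows (𝒢.mul a b h) =
    ℋ.mul (arrows a) (arrows b) (by rw [map_src, map_rng, h])
  map_inv : ∀ a, arrows (𝒢.inv a) = ℋ.inv (arrows a)

end ArrowGroupoid

/-- The transformation groupoid `X × Γ` of the right action `x.g = g⁻¹ x`: the product is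
`(x, g)(x.g, h) = (x, gh)` and the inverse is `(x, g)⁻¹ = (x.g, g⁻¹)`. -/
def transformationGroupoid (X Γ : Type*) [Group Γ] [MulAction Γ X] :
    ArrowGroupoid X (X × Γ) where
  rng a := a.1
  src a := a.2⁻¹ • a.1
  unit x := (x, 1)
  mul a b _ := (a.1, a.2 * b.2)
  inv a := (a.2⁻¹ • a.1, a.2⁻¹)
  rng_unit _ := rfl
  src_unit x := by simp
  rng_mul _ _ _ := rfl
  src_mul a b h := by simp only [mul_inv_rev, mul_smul, h]
  rng_inv _ := rfl
  src_inv a := by simp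
  mul_assoc _ _ _ _ _ := by simp only [mul_assoc]
  unit_mul a := by simp
  mul_unit a := by simp
  mul_inv a := by simp
  inv_mul a := by simp

/-! ## Inverse semigroups and the tight groupoid -/

/-- A semigroup with zero and with an involution is an inverse semigroup with zero, the inverse of
`s` being `star s`, if `s s^* s = s` for every `s` and if the idempotents commute. -/
class IsInverseSemigroup (S : Type*) [SemigroupWithZero S] [StarMul S] : Prop where
  mul_star_mul : ∀ s : S, s * star s * s = s
  idem_comm : ∀ e f : S, e * e = e → f * f = f → e * f = f * e

lemma IsInverseSemigroup.of_comm (S : Type*) [SemigroupWithZero S] [StarMul S]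
    (h1 : ∀ s : S, s * star s * s = s)
    (h2 : ∀ s t : S, (s * star s) * (t * star t) = (t * star t) * (s * star s)) :
    IsInverseSemigroup S where
  mul_star_mul := h1
  idem_comm := by
    have key (e : S) (he : e * e = e) : e * star e = e := by
      have hs : star e * star e = star e := by rw [← star_mul, he]
      have h3 : star e * e * star e = star e := by
        have := congrArg star (h1 e)
        simpa [mul_assoc] using this
      have h4 := h2 e (star e)
      rw [star_star] at h4
      have h5 : star e = e := by
        calc star e = star e * e * star e := h3.symm
          _ = (star e * e) * (e * star e) := by
            rw [← mul_assoc, mul_assoc (star e) e e, he]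
          _ = e * (star e * star e) * e := by rw [← h4]; simp only [mul_assoc]
          _ = e := by rw [hs, h1]
      rw [h5, he]
    intro e f he hf
    rw [← key e he, ← key f hf, h2]

section Tight

variable {S : Type*} [SemigroupWithZero S] [StarMul S]

variable (S) in
/-- The set `E` of projections of `S`. -/
abbrev Proj : Type _ := {e : S // IsStarProjection e}

variable [IsInverseSemigroup S]

lemma mul_star_mul (s : S) : s * star s * s = s := IsInverseSemigroup.mul_star_mul s

lemma star_mul_self_mul_star (s : S) : star s * s * star s = star s := by
  simpa using mul_star_mul (star s)

namespace Proj

lemma sq (e : Proj S) : (e : S) * e = e := e.2.isIdempotentElem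

lemma star (e : Proj S) : Star.star (e : S) = e := e.2.isSelfAdjoint

lemma comm (e f : Proj S) : (e : S) * f = f * e :=
  IsInverseSemigroup.idem_comm _ _ e.sq f.sq

instance : Mul (Proj S) where
  mul e f := ⟨e * f, by
    constructor
    · change ((e : S) * f) * (e * f) = e * f
      rw [mul_assoc, ← mul_assoc (f : S), f.comm e, mul_assoc, f.sq, ← mul_assoc, e.sq]
    · change Star.star ((e : S) * f) = e * f
      rw [star_mul, e.star, f.star, f.comm e]⟩

instance : Zero (Proj S) where
  zero := ⟨0, by
    constructor
    · change (0 : S) * 0 = 0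
      rw [mul_zero]
    · change Star.star (0 : S) = 0
      have := mul_star_mul (Star.star (0 : S))
      rw [star_star, mul_zero, zero_mul] at this
      exact this.symm⟩

lemma coe_mul (e f : Proj S) : ((e * f : Proj S) : S) = e * f := rfl

/-- The projection `s e s^*`. -/
def conj (s : S) (e : Proj S) : Proj S := ⟨s * e * Star.star s, by
  have h : Star.star s * s * e = e * (Star.star s * s) := IsInverseSemigroup.idem_comm _ _
    (by rw [← mul_assoc, star_mul_self_mul_star]) e.sq
  constructor
  · change s * e * Star.star s * (s * e * Star.star s) = s * e * Star.star s
    calc _ = s * e * (Star.star s * s * e) * Star.star s := by simp only [mul_assoc]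
      _ = s * (e * e) * (Star.star s * s * Star.star s) := by rw [h]; simp only [mul_assoc]
      _ = _ := by rw [e.sq, star_mul_self_mul_star]
  · change Star.star (s * e * Star.star s) = s * e * Star.star s
    rw [star_mul, star_mul, star_star, e.star, mul_assoc]⟩

/-- The projection `s s^*`. -/
def range (s : S) : Proj S := ⟨s * Star.star s, by
  constructor
  · change s * Star.star s * (s * Star.star s) = s * Star.star s
    rw [← mul_assoc, mul_star_mul]
  · change Star.star (s * Star.star s) = s * Star.star s
    rw [star_mul, star_star]⟩

lemma conj_mul (s : S) (e f : Proj S) : conj s (e * f) = conj s e * conj s f := by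
  apply Subtype.ext
  change s * ((e : S) * f) * Star.star s = s * e * Star.star s * (s * f * Star.star s)
  have h : e * (Star.star s * s) = Star.star s * s * e := IsInverseSemigroup.idem_comm _ _ e.sq
    (by rw [← mul_assoc, star_mul_self_mul_star])
  calc _ = s * Star.star s * s * (e * f) * Star.star s := by rw [mul_star_mul]
    _ = s * (Star.star s * s * e) * f * Star.star s := by simp only [mul_assoc]
    _ = _ := by rw [← h]; simp only [mul_assoc]

lemma conj_zero (s : S) : conj s 0 = 0 := by
  apply Subtype.ext
  change s * 0 * Star.star s = 0
  rw [mul_zero, zero_mul]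

lemma conj_conj (s t : S) (e : Proj S) : conj s (conj t e) = conj (s * t) e := by
  apply Subtype.ext
  change s * (t * e * Star.star t) * Star.star s = s * t * e * Star.star (s * t)
  rw [star_mul]; simp only [mul_assoc]

lemma conj_range (s t : S) : conj s (range t) = range (s * t) := by
  apply Subtype.ext
  change s * (t * Star.star t) * Star.star s = s * t * Star.star (s * t)
  rw [star_mul]; simp only [mul_assoc]

lemma conj_proj (e f : Proj S) : conj (e : S) f = e * f := by
  apply Subtype.ext
  change (e : S) * f * Star.star (e : S) = e * f
  rw [e.star, mul_assoc, f.comm e, ← mul_assoc, e.sq]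

lemma range_proj (e : Proj S) : range (e : S) = e := by
  apply Subtype.ext
  change (e : S) * Star.star (e : S) = e
  rw [e.star, e.sq]

lemma range_star_mul (s : S) : range (s * Star.star s) = range s := range_proj (range s)

end Proj

variable (S) in
/-- The space `Ê₀` of characters of `E`: the nonzero maps `x : E → {0, 1}` that are multiplicative
and satisfy `x 0 = 0`, with the topology of pointwise convergence. -/
structure Character where
  toFun : Proj S → Bool
  map_mul : ∀ e f, toFun (e * f) = (toFun e && toFun f)
  map_zero : toFun 0 = false
  nonzero : ∃ e, toFun e = true

namespace Character

instance : CoeFun (Character S) fun _ => Proj S → Bool := ⟨toFun⟩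

instance : TopologicalSpace (Character S) := TopologicalSpace.induced toFun inferInstance

lemma ext {x y : Character S} (h : ∀ e, x e = y e) : x = y := by
  cases x; cases y
  congr
  exact funext h

lemma conj_range_eq (s : S) : Proj.conj s (Proj.range (star s)) = Proj.range s := by
  rw [Proj.conj_range, Proj.range_star_mul]

/-- The character `x.s`, `(x.s)(e) = x(s e s^*)`, defined when `x(s s^*) = 1`. -/
def act (x : Character S) (s : S) (h : x (Proj.range s) = true) : Character S where
  toFun e := x (Proj.conj s e)
  map_mul e f := by rw [Proj.conj_mul, map_mul]
  map_zero := by rw [Proj.conj_zero, map_zero]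
  nonzero := ⟨Proj.range (star s), by rw [conj_range_eq, h]⟩

variable (S) in
/-- The set `Ê_∞` of the characters with maximal support. -/
def maximal : Set (Character S) :=
  {x | ∀ y : Character S, (∀ e, x e = true → y e = true) → x = y}

variable (S) in
/-- The set `Ê_tight`, the closure of `Ê_∞` in `Ê₀`. -/
def tight : Set (Character S) := closure (maximal S)

end Character

variable (S) in
/-- The set `Σ = {(x, s) : x ∈ D_s}`. -/
abbrev PreGerm : Type _ := {c : Character S × S // c.1 (Proj.range c.2) = true}

variable (S) in
/-- The relation `(x, s) ∼ (y, t)`: `x = y` and `e s = e t` for some `e ∈ E` with `x(e) = 1`. -/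
def germSetoid : Setoid (PreGerm S) where
  r a b := a.1.1 = b.1.1 ∧ ∃ e : Proj S, a.1.1 e = true ∧ (e : S) * a.1.2 = e * b.1.2
  iseqv := by
    refine ⟨fun a => ⟨rfl, Proj.range a.1.2, a.2, rfl⟩, ?_, ?_⟩
    · rintro a b ⟨h, e, he, h'⟩
      exact ⟨h.symm, e, h ▸ he, h'.symm⟩
    · rintro a b c ⟨h, e, he, h1⟩ ⟨h', f, hf, h2⟩
      refine ⟨h.trans h', e * f, ?_, ?_⟩
      · rw [Character.map_mul, he, h, hf]; rfl
      · rw [Proj.coe_mul]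
        calc (e : S) * f * a.1.2 = f * (e * a.1.2) := by rw [e.comm f, mul_assoc]
          _ = e * (f * b.1.2) := by rw [h1, ← mul_assoc, ← e.comm f, mul_assoc]
          _ = _ := by rw [h2, mul_assoc]

variable (S) in
/-- The set of germs `[x, s]`, the quotient of `Σ` by the relation above. -/
def Germ : Type _ := Quotient (germSetoid S)

namespace Germ

/-- The germ `[x, s]`. -/
def mk (x : Character S) (s : S) (h : x (Proj.range s) = true) : Germ S :=
  Quotient.mk (germSetoid S) ⟨(x, s), h⟩

lemma sound {x : Character S} {s t : S} (hs : x (Proj.range s) = true)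
    (ht : x (Proj.range t) = true) (e : Proj S) (he : x e = true) (h : (e : S) * s = e * t) :
    mk x s hs = mk x t ht :=
  Quotient.sound ⟨rfl, e, he, h⟩

/-- The topology on the set of germs with the basis `θ(s, U) = {[x, s] : x ∈ U}`, for `s ∈ S` and
`U ⊆ D_s` open. -/
instance : TopologicalSpace (Germ S) := TopologicalSpace.generateFrom
  {θ | ∃ (s : S) (U : Set (Character S)), IsOpen U ∧ (∀ x ∈ U, x (Proj.range s) = true) ∧
    θ = {γ | ∃ x ∈ U, ∃ h, γ = mk x s h}}

/-- The range `x` of the germ `[x, s]`. -/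
def rng : Germ S → Character S := Quotient.lift (fun a => a.1.1) fun _ _ h => h.1

lemma act_congr {x : Character S} {s t : S} (hs : x (Proj.range s) = true)
    (ht : x (Proj.range t) = true) (e : Proj S) (he : x e = true) (h : (e : S) * s = e * t) :
    x.act s hs = x.act t ht := by
  have key (s : S) (f : Proj S) : x (Proj.conj s f) = x (Proj.conj (e * s) f) := by
    rw [← Proj.conj_conj, Proj.conj_proj, Character.map_mul, he, Bool.true_and]
  refine Character.ext fun f => ?_
  change x (Proj.conj s f) = x (Proj.conj t f)
  rw [key s, key t, h]

/-- The source `x.s` of the germ `[x, s]`. -/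
def src : Germ S → Character S := Quotient.lift (fun a => a.1.1.act a.1.2 a.2) (by
  rintro ⟨⟨x, s⟩, hs⟩ ⟨⟨y, t⟩, ht⟩ ⟨h, e, he, h'⟩
  obtain rfl : x = y := h
  exact act_congr hs ht e he h')

lemma range_mul {x : Character S} {s t : S} (hs : x (Proj.range s) = true)
    (ht : x.act s hs (Proj.range t) = true) : x (Proj.range (s * t)) = true := by
  rw [← Proj.conj_range]; exact ht

lemma range_star {x : Character S} {s : S} (hs : x (Proj.range s) = true) :
    x.act s hs (Proj.range (star s)) = true := by
  change x (Proj.conj s (Proj.range (star s))) = true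
  rw [Character.conj_range_eq, hs]

lemma mul_sound {x : Character S} {s s' t t' : S} (hs : x (Proj.range s) = true)
    (ht : x (Proj.range (s * t)) = true)
    (ht' : x (Proj.range (s' * t')) = true) (e : Proj S) (he : x e = true)
    (h : (e : S) * s = e * s') (f : Proj S) (hf : x.act s hs f = true)
    (h' : (f : S) * t = f * t') : mk x (s * t) ht = mk x (s' * t') ht' := by
  have hg : e * Proj.conj s f = e * Proj.conj s' f := by
    rw [← Proj.conj_proj, ← Proj.conj_proj, Proj.conj_conj, Proj.conj_conj, h]
  have key (s t : S) : ((e * Proj.conj s f : Proj S) : S) * (s * t) = e * s * (f * t) := by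
    have hc : star s * s * f = f * (star s * s) := IsInverseSemigroup.idem_comm _ _
      (by rw [← mul_assoc, star_mul_self_mul_star]) f.sq
    calc (e : S) * (s * f * star s) * (s * t) = e * s * (f * (star s * s)) * t := by
          simp only [mul_assoc]
      _ = e * (s * star s * s) * (f * t) := by rw [← hc]; simp only [mul_assoc]
      _ = _ := by rw [mul_star_mul]
  refine sound _ _ (e * Proj.conj s f) ?_ ?_
  · rw [Character.map_mul, he, Bool.true_and]; exact hf
  · rw [key]
    rw [hg, key, h, h']

/-- The product `[x, s][x.s, t] = [x, st]`. -/
def mul (a b : Germ S) : src a = rng b → Germ S :=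
  Quotient.hrecOn₂ (φ := fun a b => src a = rng b → Germ S) a b
    (fun a b h => mk a.1.1 (a.1.2 * b.1.2) (range_mul a.2 (by
      have h' : a.1.1.act a.1.2 a.2 = b.1.1 := h
      rw [h']; exact b.2)))
    (by
      rintro ⟨⟨x, s⟩, hs⟩ ⟨⟨y, t⟩, ht⟩ ⟨⟨x', s'⟩, hs'⟩ ⟨⟨y', t'⟩, ht'⟩ ⟨h1, e, he, h1'⟩
        ⟨h2, f, hf, h2'⟩
      obtain rfl : x = x' := h1
      obtain rfl : y = y' := h2
      refine Function.hfunext ?_ ?_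
      · change (x.act s hs = y) = (x.act s' hs' = y)
        rw [act_congr hs hs' e he h1']
      · intro h h' _
        apply heq_of_eq
        have h0 : x.act s hs = y := h
        exact mul_sound hs _ _ e he h1' f (h0 ▸ hf) h2')

/-- The inverse `[x, s]⁻¹ = [x.s, s^*]`. -/
def inv : Germ S → Germ S :=
  Quotient.lift (fun a => mk (a.1.1.act a.1.2 a.2) (star a.1.2) (range_star a.2)) (by
    rintro ⟨⟨x, s⟩, hs⟩ ⟨⟨y, t⟩, ht⟩ ⟨h, e, he, h'⟩
    obtain rfl : x = y := h
    have h0 := act_congr hs ht e he h'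
    have h1 : star s * (e : S) = star t * e := by
      have := congrArg star h'
      simpa [e.star] using this
    refine Quotient.sound ⟨h0, Proj.conj (star s) e, ?_, ?_⟩
    · change x (Proj.conj s (Proj.conj (star s) e)) = true
      rw [Proj.conj_conj]
      change x (Proj.conj (Proj.range s : Proj S) e) = true
      rw [Proj.conj_proj, Character.map_mul, hs, he]; rfl
    · have key (s : S) : star s * (e : S) * s * star s = star s * e := by
        have hc : (e : S) * (s * star s) = s * star s * e := e.comm (Proj.range s)
        rw [mul_assoc, mul_assoc, hc, ← mul_assoc, ← mul_assoc, star_mul_self_mul_star]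
      have h2 : star s * (e : S) * s = star t * (e : S) * t := by
        calc star s * (e : S) * s = (star s * e) * (e * s) := by
              rw [mul_assoc, mul_assoc, ← mul_assoc (e : S), e.sq]
          _ = (star t * e) * (e * t) := by rw [h1, h']
          _ = _ := by rw [mul_assoc, mul_assoc, ← mul_assoc (e : S), e.sq]
      change star s * (e : S) * star (star s) * star s = star s * (e : S) * star (star s) * star t
      rw [star_star, key, h2, key, h1])

/-- The unit at `x`, which is `[x, e]` for any projection `e` with `x(e) = 1`. -/
def unit (x : Character S) : Germ S :=
  mk x (x.nonzero.choose : Proj S) (by rw [Proj.range_proj]; exact x.nonzero.choose_spec)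

lemma unit_eq (x : Character S) (e : Proj S) (he : x e = true) :
    unit x = mk x e (by rw [Proj.range_proj, he]) := by
  refine sound _ _ (x.nonzero.choose * e) ?_ ?_
  · rw [Character.map_mul, he, Bool.and_true]; exact x.nonzero.choose_spec
  · rw [Proj.coe_mul, mul_assoc, mul_assoc, e.sq, e.comm, ← mul_assoc, Proj.sq]

lemma act_proj (x : Character S) (e : Proj S) (he : x e = true)
    (h : x (Proj.range (e : S)) = true) : x.act e h = x := by
  refine Character.ext fun f => ?_
  change x (Proj.conj (e : S) f) = x f
  rw [Proj.conj_proj, Character.map_mul, he, Bool.true_and]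

end Germ

open CuntzLi.Germ in
variable (S) in
/-- Exel's groupoid `𝒢 = Σ/∼` of germs of the action of `S` on `Ê₀`. -/
def germGroupoid : ArrowGroupoid (Character S) (Germ S) where
  rng := rng
  src := src
  unit := unit
  mul := mul
  inv := inv
  rng_unit _ := rfl
  src_unit x := act_proj x _ x.nonzero.choose_spec
    (by rw [Proj.range_proj]; exact x.nonzero.choose_spec)
  rng_mul := by
    rintro ⟨a⟩ ⟨b⟩ h; rfl
  src_mul := by
    rintro ⟨⟨⟨x, s⟩, hs⟩⟩ ⟨⟨⟨y, t⟩, ht⟩⟩ h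
    obtain rfl : x.act s hs = y := h
    refine Character.ext fun f => ?_
    change x (Proj.conj (s * t) f) = x (Proj.conj s (Proj.conj t f))
    rw [Proj.conj_conj]
  rng_inv := by
    rintro ⟨a⟩; rfl
  src_inv := by
    rintro ⟨⟨⟨x, s⟩, hs⟩⟩
    refine Character.ext fun f => ?_
    change x (Proj.conj s (Proj.conj (star s) f)) = x f
    rw [Proj.conj_conj]
    change x (Proj.conj (Proj.range s : Proj S) f) = x f
    rw [Proj.conj_proj, Character.map_mul, hs, Bool.true_and]
  mul_assoc := by
    rintro ⟨⟨⟨x, s⟩, hs⟩⟩ ⟨⟨⟨y, t⟩, ht⟩⟩ ⟨⟨⟨z, v⟩, hv⟩⟩ h h'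
    refine sound _ _ (Proj.range s) hs ?_
    simp only [mul_assoc]
  unit_mul := by
    rintro ⟨⟨⟨x, s⟩, hs⟩⟩
    refine Quotient.sound ⟨rfl, x.nonzero.choose, x.nonzero.choose_spec, ?_⟩
    change (x.nonzero.choose : S) * (x.nonzero.choose * s) = _
    rw [← mul_assoc, Proj.sq]
  mul_unit := by
    rintro ⟨⟨⟨x, s⟩, hs⟩⟩
    set e := (x.act s hs).nonzero.choose with he
    have he' : x (Proj.conj s e) = true := (x.act s hs).nonzero.choose_spec
    refine sound _ _ (Proj.conj s e) he' ?_
    change s * (e : S) * star s * (s * e) = s * (e : S) * star s * s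
    have hc : star s * s * e = e * (star s * s) := IsInverseSemigroup.idem_comm _ _
      (by rw [← mul_assoc, star_mul_self_mul_star]) e.sq
    calc _ = s * (e : S) * (star s * s * e) := by simp only [mul_assoc]
      _ = s * ((e : S) * e) * (star s * s) := by rw [hc]; simp only [mul_assoc]
      _ = _ := by rw [e.sq]; simp only [mul_assoc]
  mul_inv := by
    rintro ⟨⟨⟨x, s⟩, hs⟩⟩
    exact (unit_eq x (Proj.range s) hs).symm
  inv_mul := by
    rintro ⟨⟨⟨x, s⟩, hs⟩⟩
    refine Eq.trans ?_ (unit_eq (x.act s hs) (Proj.range (star s)) (range_star hs)).symm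
    refine sound _ _ (Proj.range (star s)) (range_star hs) ?_
    change star s * star (star s) * (star s * s) = star s * star (star s) * (star s * star (star s))
    rw [star_star]

variable (S) in
/-- The set of arrows of the tight groupoid. -/
abbrev TightArrow : Type _ := {γ : Germ S //
  (germGroupoid S).rng γ ∈ Character.tight S ∧ (germGroupoid S).src γ ∈ Character.tight S}

variable (S) in
/-- Exel's tight groupoid `𝒢_tight`: the reduction of `𝒢` to `Ê_tight`. -/
def tightGroupoid : ArrowGroupoid (Character.tight S) (TightArrow S) :=
  (germGroupoid S).restrict (Character.tight S)

end Tight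

/-! ## The arithmetic side -/

/-- The ring `ℤ̂` of compatible families `(r_m)` in `∏ ℤ/(m)`. -/
def ZHat : Subring (∀ m : ℕ+, ZMod m) where
  carrier := {r | ∀ m k : ℕ+,
    ZMod.castHom (Dvd.intro (k : ℕ) (PNat.mul_coe m k).symm) (ZMod m) (r (m * k)) = r m}
  mul_mem' {a b} ha hb m k := by
    rw [Pi.mul_apply, map_mul, ha, hb]; rfl
  one_mem' m k := by rw [Pi.one_apply, map_one]; rfl
  add_mem' {a b} ha hb m k := by
    rw [Pi.add_apply, map_add, ha, hb]; rfl
  zero_mem' m k := by rw [Pi.zero_apply, map_zero]; rfl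
  neg_mem' {a} ha m k := by
    rw [Pi.neg_apply, map_neg, ha]; rfl

/-- Equality in the inductive limit of the groups `𝓡_p = ℤ̂` (`p ∈ ℕ⁺`, ordered by divisibility)
along the maps `𝓡_p → 𝓡_{pℓ}` given by multiplication by `ℓ`: the elements `x ∈ 𝓡_p` and
`y ∈ 𝓡_q` are identified if they have the same image in some `𝓡_{pk} = 𝓡_{ql}`. -/
def limSetoid : Setoid (Σ _ : ℕ+, ZHat) where
  r a b := ∃ k l : ℕ+, a.1 * k = b.1 * l ∧ (k : ZHat) * a.2 = (l : ZHat) * b.2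
  iseqv := by
    refine ⟨fun a => ⟨1, 1, rfl, rfl⟩, ?_, ?_⟩
    · rintro a b ⟨k, l, h, h'⟩
      exact ⟨l, k, h.symm, h'.symm⟩
    · rintro ⟨p, x⟩ ⟨q, y⟩ ⟨r, z⟩ ⟨k, l, h, h'⟩ ⟨k', l', h1, h1'⟩
      dsimp only at *
      refine ⟨k * k', l' * l, ?_, ?_⟩
      · rw [← mul_assoc, h, mul_assoc, mul_comm l, ← mul_assoc, h1, mul_assoc]
      · push_cast
        linear_combination (k' : ZHat) * h' + (l : ZHat) * h1'

/-- The inductive limit `𝓡` of copies `𝓡_p` of `ℤ̂`. -/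
def RLim : Type := Quotient limSetoid

namespace RLim

/-- The image in `𝓡` of the element `x` of `𝓡_p = ℤ̂`. -/
def mk (p : ℕ+) (x : ZHat) : RLim := Quotient.mk limSetoid ⟨p, x⟩

/-- The inductive limit topology. -/
instance : TopologicalSpace RLim :=
  inferInstanceAs (TopologicalSpace (Quotient limSetoid))

/-- The inclusion `ℤ̂ = 𝓡_1 ⊆ 𝓡`. -/
def incl (r : ZHat) : RLim := mk 1 r

lemma mk_mul (p l : ℕ+) (x : ZHat) : mk (p * l) (l * x) = mk p x :=
  Quotient.sound ⟨1, l, mul_one _, by simp⟩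

end RLim

/-- The group `P_ℚ` of the matrices `[[1, 0], [b, a]]` with `a ∈ ℚ^×` and `b ∈ ℚ`. -/
def affineSubgroup : Subgroup (GL (Fin 2) ℚ) where
  carrier := {g | g 0 0 = 1 ∧ g 0 1 = 0}
  mul_mem' {g h} hg hh := by
    constructor <;> simp [Matrix.mul_apply, hg.1, hg.2, hh.1, hh.2]
  one_mem' := by simp
  inv_mem' {g} hg := by
    have h : (g : Matrix (Fin 2) (Fin 2) ℚ) * (g⁻¹ : GL (Fin 2) ℚ) = 1 := by
      rw [← Units.val_mul, mul_inv_cancel, Units.val_one]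
    have h0 := congrFun (congrFun h 0) 0
    have h1 := congrFun (congrFun h 0) 1
    simp only [Matrix.mul_apply, Fin.sum_univ_two, hg.1, hg.2] at h0 h1
    exact ⟨by simpa using h0, by simpa using h1⟩

/-- `P_ℚ` as a discrete group. -/
def PQ : Type := affineSubgroup

namespace PQ

instance : Group PQ := inferInstanceAs (Group affineSubgroup)

instance : TopologicalSpace PQ := ⊥

instance : DiscreteTopology PQ := ⟨rfl⟩

/-- The entry `a` of the matrix `[[1, 0], [b, a]]`. -/
def a (g : PQ) : ℚ := g.1 1 1

/-- The entry `b` of the matrix `[[1, 0], [b, a]]`. -/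
def b (g : PQ) : ℚ := g.1 1 0

/-- The matrix `[[1, 0], [b, a]]`. -/
def mk (b a : ℚ) (ha : a ≠ 0) : PQ :=
  ⟨Matrix.GeneralLinearGroup.mkOfDetNeZero !![1, 0; b, a] (by simpa using ha), by
    constructor <;> simp [Matrix.GeneralLinearGroup.mkOfDetNeZero]⟩

lemma a_one : a 1 = 1 := by
  change ((1 : GL (Fin 2) ℚ) : Matrix (Fin 2) (Fin 2) ℚ) 1 1 = 1
  simp

lemma b_one : b 1 = 0 := by
  change ((1 : GL (Fin 2) ℚ) : Matrix (Fin 2) (Fin 2) ℚ) 1 0 = 0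
  simp

lemma a_mul (g h : PQ) : a (g * h) = a g * a h := by
  change ((g.1 * h.1 : GL (Fin 2) ℚ) : Matrix (Fin 2) (Fin 2) ℚ) 1 1 = _
  rw [Units.val_mul, Matrix.mul_apply, Fin.sum_univ_two, h.2.2, mul_zero, zero_add]
  rfl

lemma b_mul (g h : PQ) : b (g * h) = b g + a g * b h := by
  change ((g.1 * h.1 : GL (Fin 2) ℚ) : Matrix (Fin 2) (Fin 2) ℚ) 1 0 = _
  rw [Units.val_mul, Matrix.mul_apply, Fin.sum_univ_two, h.2.1, mul_one]
  rfl

end PQ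

namespace RLim

/-- The map of `𝓡` that sends `x ∈ 𝓡_p` to `m x + n p ∈ 𝓡_{d p}`. -/
def affine (d : ℕ+) (n m : ℤ) : RLim → RLim :=
  Quotient.lift (fun c => mk (d * c.1) (m * c.2 + n * (c.1 : ZHat))) (by
    rintro ⟨p, x⟩ ⟨q, y⟩ ⟨k, l, h, h'⟩
    dsimp only at h h'
    refine Quotient.sound ⟨k, l, ?_, ?_⟩
    · dsimp only
      rw [mul_assoc, mul_assoc, h]
    · have h1 : (p : ZHat) * k = q * l := by exact_mod_cast congrArg (fun t : ℕ+ => ((t : ℕ) : ZHat)) h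
      dsimp only
      linear_combination (m : ZHat) * h' + (n : ZHat) * h1)

lemma affine_mk (d p : ℕ+) (n m : ℤ) (x : ZHat) :
    affine d n m (mk p x) = mk (d * p) (m * x + n * (p : ZHat)) := rfl

lemma affine_congr {d d' : ℕ+} {n n' m m' : ℤ} (hn : n * d' = n' * d) (hm : m * d' = m' * d) :
    affine d n m = affine d' n' m' := by
  funext c
  obtain ⟨p, x⟩ := c
  refine Quotient.sound ⟨d', d, ?_, ?_⟩
  · dsimp only
    rw [mul_right_comm, mul_comm d d', mul_right_comm]
  · have h1 : (n : ZHat) * d' = n' * d := by exact_mod_cast congrArg (fun t : ℤ => (t : ZHat)) hn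
    have h2 : (m : ZHat) * d' = m' * d := by exact_mod_cast congrArg (fun t : ℤ => (t : ZHat)) hm
    dsimp only
    linear_combination x * h2 + (p : ZHat) * h1

/-- The action of `P_ℚ` on `𝓡`, computed with one common denominator of the entries `a`, `b`; see
`smul_mk` for the formula with an arbitrary common denominator. -/
instance : SMul PQ RLim where
  smul g := affine ⟨g.b.den * g.a.den, Nat.mul_pos g.b.den_pos g.a.den_pos⟩
    (g.b.num * g.a.den) (g.a.num * g.b.den)

lemma smul_eq (g : PQ) (d : ℕ+) (n m : ℤ) (hb : g.b = n / d) (ha : g.a = m / d) (c : RLim) :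
    g • c = affine d n m c := by
  have hd : (d : ℚ) ≠ 0 := by exact_mod_cast d.ne_zero
  have h1 : (g.b.num : ℚ) * d = n * g.b.den := by
    rw [eq_div_iff hd, ← Rat.num_div_den g.b] at hb
    have := g.b.den_nz
    field_simp at hb
    linear_combination hb
  have h2 : (g.a.num : ℚ) * d = m * g.a.den := by
    rw [eq_div_iff hd, ← Rat.num_div_den g.a] at ha
    have := g.a.den_nz
    field_simp at ha
    linear_combination ha
  have h1' : g.b.num * (d : ℤ) = n * g.b.den := by exact_mod_cast h1
  have h2' : g.a.num * (d : ℤ) = m * g.a.den := by exact_mod_cast h2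
  refine congrFun (affine_congr ?_ ?_) c
  · push_cast [PNat.mk_coe]
    linear_combination (g.a.den : ℤ) * h1'
  · push_cast [PNat.mk_coe]
    linear_combination (g.b.den : ℤ) * h2'

lemma smul_mk (g : PQ) (d : ℕ+) (n m : ℤ) (hb : g.b = n / d) (ha : g.a = m / d) (p : ℕ+)
    (x : ZHat) : g • mk p x = mk (d * p) (m * x + n * (p : ZHat)) :=
  smul_eq g d n m hb ha (mk p x)

lemma exists_rep (g : PQ) : ∃ (d : ℕ+) (n m : ℤ), g.b = n / d ∧ g.a = m / d := by
  refine ⟨⟨g.b.den * g.a.den, Nat.mul_pos g.b.den_pos g.a.den_pos⟩, g.b.num * g.a.den,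
    g.a.num * g.b.den, ?_, ?_⟩
  · push_cast [PNat.mk_coe]
    rw [mul_div_mul_right _ _ (by exact_mod_cast g.a.den_nz), Rat.num_div_den]
  · push_cast [PNat.mk_coe]
    rw [mul_comm (g.b.den : ℚ), mul_div_mul_right _ _ (by exact_mod_cast g.b.den_nz),
      Rat.num_div_den]

instance : MulAction PQ RLim where
  one_smul c := by
    obtain ⟨p, x⟩ := c
    change (1 : PQ) • mk p x = mk p x
    rw [smul_mk 1 1 0 1 (by simp [PQ.b_one]) (by simp [PQ.a_one])]
    simp
  mul_smul g h c := by
    obtain ⟨p, x⟩ := c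
    change (g * h) • mk p x = g • h • mk p x
    obtain ⟨d, n, m, hb, ha⟩ := exists_rep g
    obtain ⟨d', n', m', hb', ha'⟩ := exists_rep h
    have hd : (d : ℚ) ≠ 0 := by exact_mod_cast d.ne_zero
    have hd' : (d' : ℚ) ≠ 0 := by exact_mod_cast d'.ne_zero
    rw [smul_mk h d' n' m' hb' ha', smul_mk g d n m hb ha,
      smul_mk (g * h) (d * d') (n * d' + m * n') (m * m') ?_ ?_]
    · rw [mul_assoc]
      congr 1
      push_cast
      ring
    · rw [PQ.b_mul, hb, ha, hb']
      push_cast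
      field_simp
    · rw [PQ.a_mul, ha, ha']
      push_cast
      field_simp

end RLim

/-- The subset `ℤ̂ ⊆ 𝓡`. -/
def zhatSet : Set RLim := Set.range RLim.incl

/-- The set of arrows of the reduction of `𝓡 × P_ℚ` to `ℤ̂`. -/
abbrev AffineArrow : Type := {γ : RLim × PQ //
  (transformationGroupoid RLim PQ).rng γ ∈ zhatSet ∧
    (transformationGroupoid RLim PQ).src γ ∈ zhatSet}

/-- The groupoid `(𝓡 × P_ℚ)|_ℤ̂`. -/
def affineGroupoid : ArrowGroupoid zhatSet AffineArrow :=
  (transformationGroupoid RLim PQ).restrict zhatSet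


/-! ## The universal C*-algebra `U[ℤ]` and its inverse semigroup `T` -/

/-- A family satisfying the relations, in some nonzero unital C*-algebra. A family in any C*-algebra
generates a separable subalgebra, which is isomorphic to a C*-algebra in `Type`; so nothing is lost
by this choice of universe. -/
structure Model : Type 1 where
  B : Type
  [cstar : CStarAlgebra B]
  [nontriv : Nontrivial B]
  fam : Family B

attribute [instance] Model.cstar Model.nontriv

/-- The C*-algebra of all bounded elements of the product of all models. -/
abbrev BigProd : Type 1 := lp (fun M : Model => M.B) ∞

instance : CStarAlgebra BigProd where

namespace BigProd

/-- The bounded family `(x_M)` with `‖x_M‖ ≤ 1`. -/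
def of (x : ∀ M : Model, M.B) (hx : ∀ M, ‖x M‖ ≤ 1) : BigProd :=
  ⟨x, memℓp_infty ⟨1, by rintro _ ⟨M, rfl⟩; exact hx M⟩⟩

lemma norm_u (M : Model) (n : ℤ) : ‖M.fam.u n‖ ≤ 1 :=
  (CStarRing.norm_of_mem_unitary (M.fam.u_unitary n)).le

lemma norm_s (M : Model) (m : ℤ⁰) : ‖M.fam.s m‖ ≤ 1 := by
  have h := CStarRing.norm_star_mul_self (x := M.fam.s m)
  rw [M.fam.s_isometry, norm_one] at h
  nlinarith [norm_nonneg (M.fam.s m)]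

/-- The tuple of the unitaries `u^n` of all models. -/
def u (n : ℤ) : BigProd := of (fun M => M.fam.u n) fun M => norm_u M n

/-- The tuple of the isometries `s_m` of all models. -/
def s (m : ℤ⁰) : BigProd := of (fun M => M.fam.s m) fun M => norm_s M m

lemma ext {x y : BigProd} (h : ∀ M, x M = y M) : x = y := lp.ext (funext h)

/-- The coordinate projections. -/
def eval (M : Model) : BigProd →⋆ₐ[ℂ] M.B where
  toFun x := x M
  map_one' := rfl
  map_mul' _ _ := rfl
  map_zero' := rfl
  map_add' _ _ := rfl
  commutes' _ := rfl
  map_star' _ := rfl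

lemma eq_of_eval {x y : BigProd} (h : ∀ M, eval M x = eval M y) : x = y := ext h

/-- The tuples satisfy the relations. -/
def fam : Family BigProd where
  u := u
  s := s
  u_unitary n := by
    rw [Unitary.mem_iff]
    constructor <;> refine eq_of_eval fun M => ?_ <;> rw [map_mul, map_star, map_one]
    · exact Unitary.star_mul_self_of_mem (M.fam.u_unitary n)
    · exact Unitary.mul_star_self_of_mem (M.fam.u_unitary n)
  s_isometry m := eq_of_eval fun M => by
    rw [map_mul, map_star, map_one]; exact M.fam.s_isometry m
  s_mul m n := eq_of_eval fun M => by rw [map_mul]; exact M.fam.s_mul m n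
  u_mul m n := eq_of_eval fun M => by rw [map_mul]; exact M.fam.u_mul m n
  s_mul_u m n := eq_of_eval fun M => by rw [map_mul, map_mul]; exact M.fam.s_mul_u m n
  sum_eq_one m := eq_of_eval fun M => by
    rw [map_sum, map_one]
    simp only [map_mul, map_star]
    exact M.fam.sum_eq_one m

end BigProd

/-- The universal C*-algebra `U[ℤ]`, realised as the C*-subalgebra of the product of all models that
is generated by the tuples of the generators. -/
def uzSub : StarSubalgebra ℂ BigProd :=
  (StarAlgebra.adjoin ℂ (Set.range BigProd.u ∪ Set.range BigProd.s)).topologicalClosure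

instance : IsClosed (uzSub : Set BigProd) := StarSubalgebra.isClosed_topologicalClosure _

/-- The universal C*-algebra `U[ℤ]`. -/
abbrev UZ : Type 1 := uzSub

instance : CStarAlgebra UZ := StarSubalgebra.cstarAlgebra uzSub

namespace UZ

lemma u_mem (n : ℤ) : BigProd.u n ∈ uzSub :=
  StarSubalgebra.le_topologicalClosure _ (StarAlgebra.subset_adjoin ℂ _ (Or.inl ⟨n, rfl⟩))

lemma s_mem (m : ℤ⁰) : BigProd.s m ∈ uzSub :=
  StarSubalgebra.le_topologicalClosure _ (StarAlgebra.subset_adjoin ℂ _ (Or.inr ⟨m, rfl⟩))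

/-- The canonical generators of `U[ℤ]`. -/
def gen : Family UZ where
  u n := ⟨BigProd.u n, u_mem n⟩
  s m := ⟨BigProd.s m, s_mem m⟩
  u_unitary n := by
    have h := Unitary.mem_iff.1 (BigProd.fam.u_unitary n)
    exact Unitary.mem_iff.2 ⟨Subtype.ext h.1, Subtype.ext h.2⟩
  s_isometry m := Subtype.ext (BigProd.fam.s_isometry m)
  s_mul m n := Subtype.ext (BigProd.fam.s_mul m n)
  u_mul m n := Subtype.ext (BigProd.fam.u_mul m n)
  s_mul_u m n := Subtype.ext (BigProd.fam.s_mul_u m n)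
  sum_eq_one m := Subtype.ext (by
    have h := BigProd.fam.sum_eq_one m
    push_cast
    exact h)

open scoped CStarAlgebra in
/-- The universal property of `U[ℤ]`. -/
theorem existsUnique_hom {B : Type} [CStarAlgebra B] (F : Family B) :
    ∃! π : UZ →⋆ₐ[ℂ] B, (∀ n, π (gen.u n) = F.u n) ∧ ∀ m, π (gen.s m) = F.s m := by
  rcases subsingleton_or_nontrivial B with hB | hB
  · exact ⟨{ toFun := fun _ => 0, map_one' := Subsingleton.elim _ _,
             map_mul' := fun _ _ => Subsingleton.elim _ _, map_zero' := rfl,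
             map_add' := fun _ _ => Subsingleton.elim _ _,
             commutes' := fun _ => Subsingleton.elim _ _,
             map_star' := fun _ => Subsingleton.elim _ _ },
      ⟨fun _ => Subsingleton.elim _ _, fun _ => Subsingleton.elim _ _⟩,
      fun _ _ => StarAlgHom.ext fun _ => Subsingleton.elim _ _⟩
  · refine ⟨(BigProd.eval ⟨B, F⟩).comp uzSub.subtype, ⟨fun _ => rfl, fun _ => rfl⟩, ?_⟩
    rintro π ⟨hu, hs⟩
    have h1 : Continuous (fun x : UZ => π x) := map_continuous π
    have h2 : Continuous (fun x : UZ => ((BigProd.eval ⟨B, F⟩).comp uzSub.subtype) x) :=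
      map_continuous ((BigProd.eval ⟨B, F⟩).comp uzSub.subtype)
    refine StarAlgHom.ext_topologicalClosure h1 h2 ?_
    refine StarAlgHom.ext_adjoin fun x hx => ?_
    rcases x with ⟨x, hx'⟩
    rcases hx with ⟨n, rfl⟩ | ⟨m, rfl⟩
    · exact hu n
    · exact hs m

end UZ

/-! ### `T` as an inverse semigroup -/

namespace Family

variable {A : Type*} [CStarAlgebra A] (F : Family A)

instance : SemigroupWithZero F.T where
  mul x y := ⟨x.1 * y.1, F.mul_mem_T x.2 y.2⟩
  mul_assoc x y z := Subtype.ext (mul_assoc x.1 y.1 z.1)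
  zero := ⟨0, Or.inr rfl⟩
  zero_mul x := Subtype.ext (zero_mul x.1)
  mul_zero x := Subtype.ext (mul_zero x.1)

instance : StarMul F.T where
  star x := ⟨star x.1, F.star_mem_T x.2⟩
  star_involutive x := Subtype.ext (star_star x.1)
  star_mul x y := Subtype.ext (star_mul x.1 y.1)

instance : IsInverseSemigroup F.T := IsInverseSemigroup.of_comm _
  (fun x => Subtype.ext (F.mul_star_mul x.2))
  (fun x y => Subtype.ext (F.comm_of_mem_P (F.mul_star_mem_P x.2) (F.mul_star_mem_P y.2)))

/-- The element `s_m^* u^k s_n` of `T`. -/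
def word (m : ℤ⁰) (k : ℤ) (n : ℤ⁰) : F.T :=
  ⟨star (F.s m) * F.u k * F.s n, Or.inl ⟨m, n, 1, k, 0, by simp [F.e_one, F.u_zero]⟩⟩

/-- The projection `u^n e_m u^{-n}` of `T`. -/
def proj (n : ℤ) (m : ℤ⁰) : Proj F.T :=
  ⟨⟨F.u n * F.e m * F.u (-n), Or.inl ⟨1, 1, m, n, -n, by simp [F.s_one]⟩⟩,
    Subtype.ext (F.p_sq n m), Subtype.ext (F.p_star n m)⟩

end Family

/-- The inverse semigroup `T` of `U[ℤ]`. -/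
abbrev TZ : Type 1 := UZ.gen.T

/-- The positive integer `m` as a nonzero integer. -/
def nz (m : ℕ+) : ℤ⁰ := ⟨m, mem_nonZeroDivisors_of_ne_zero (by exact_mod_cast m.ne_zero)⟩

/-- `x` is the character `ξ_r`: `ξ_r(u^n e_m u^{-n})` is `1` if `r_m = n` in `ℤ/(m)`, and `0`
otherwise. These equations, for `m > 0`, determine `x`, because `e_{-m} = e_m`. -/
def IsXi (r : ZHat) (x : Character TZ) : Prop :=
  ∀ (n : ℤ) (m : ℕ+), x (UZ.gen.proj n (nz m)) = true ↔ r.1 m = (n : ZMod m)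

lemma frac_ne_zero (n m : ℤ⁰) : ((n : ℤ) : ℚ) / ((m : ℤ) : ℚ) ≠ 0 :=
  div_ne_zero (Int.cast_ne_zero.2 (nonZeroDivisors.coe_ne_zero n))
    (Int.cast_ne_zero.2 (nonZeroDivisors.coe_ne_zero m))

/-- The matrix `[[1, 0], [k/m, n/m]]` of `P_ℚ`. -/
def PQ.frac (k : ℤ) (n m : ℤ⁰) : PQ :=
  PQ.mk ((k : ℚ) / (m : ℤ)) ((n : ℤ) / (m : ℤ)) (frac_ne_zero n m)

end CuntzLi

end

open CuntzLi

noncomputable section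

namespace CuntzLi

/-! The nonzero projections of `T` are the `u^n e_m u^{-n}`, and they multiply like the cosets `n +
(m)` of `ℤ`: a coset modulo a multiple lies below the larger coset containing it, and distinct
cosets of one modulus are orthogonal. A character of the projections is therefore a filter of
cosets, and `ξ_r` is the filter of all cosets whose closure in `ℤ̂` contains `r`. Distinct cosets
modulo `m` are disjoint, so no character lies strictly above `ξ_r` (`eq_xi`); compactness of `ℤ̂`
puts every character below some `ξ_r` (`exists_xi_ge`). Hence the maximal characters are exactly the
`ξ_r`. They form the injective continuous image of a compact space in a Hausdorff space, which is
closed, so the tight spectrum is a copy of `ℤ̂` (`tight_eq_range`).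

For the arrows, every element of `T` is a projection times a word `s_m^* u^k s_n`, so every germ is
the germ of a word (`Germ.exists_eq_mk_word`). A word depends only on the matrix with entries `k/m`,
`n/m` (`word_scale`), and words multiply like matrices up to a projection that does not affect the
germ (`word_mul_word`). The character `ξ_r` lies in the domain of the word exactly when `m r = n r'
+ k` for some `r'` in `ℤ̂`, that is, when `g⁻¹ r` lies in `ℤ̂`, and the source of the germ is then
`ξ_{r'}`.

Distinct matrices must also give distinct germs. This is seen in the representation on `ℓ²(ℤ)`,
where words act as partial affine maps of `ℤ`: two words that agree below a nonzero projection give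
affine maps that agree on a whole coset, hence the same matrix (`UZ.frac_eq_of_p_mul_word`). In both
topologies an arrow is, locally, a point of `ℤ̂` together with a fixed matrix, so the bijection is a
homeomorphism. Continuity of the operations is evident for the transformation groupoid and is
transported to the tight groupoid. -/

/-! ### The representation of `U[ℤ]` on `ℓ²(ℤ)` -/

/-- The Hilbert space `ℓ²(ℤ)`. -/
abbrev EllTwo : Type := lp (fun _ : ℤ => ℂ) 2

namespace EllTwo

/-- The standard basis vector at `j`. -/
def δ (j : ℤ) : EllTwo := lp.single 2 j (1 : ℂ)

lemma inner_δ (i : ℤ) (x : EllTwo) : inner ℂ (δ i) x = x i := by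
  simp [δ, lp.inner_single_left]

lemma δ_apply (i j : ℤ) : δ i j = if j = i then 1 else 0 := by
  simp [δ, Pi.single_apply]

lemma orthonormal_δ : Orthonormal ℂ δ := by
  rw [orthonormal_iff_ite]
  intro i j
  rw [inner_δ, δ_apply]

lemma δ_injective : Function.Injective δ := fun i j h => by
  have := congrArg (fun x : EllTwo => x i) h
  simpa [δ_apply] using this

lemma δ_ne_zero (i : ℤ) : δ i ≠ 0 := orthonormal_δ.ne_zero i

lemma clm_ext {a b : EllTwo →L[ℂ] EllTwo} (h : ∀ j, a (δ j) = b (δ j)) : a = b := by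
  refine lp.ext_continuousLinearMap (by simp) fun i => ?_
  ext1
  exact h i

/-- The isometry of `ℓ²(ℤ)` induced by an injective map of `ℤ`. -/
def push (f : ℤ → ℤ) (hf : Function.Injective f) : EllTwo →L[ℂ] EllTwo :=
  (orthonormal_δ.comp f hf).orthogonalFamily.linearIsometry.toContinuousLinearMap

variable {f : ℤ → ℤ} (hf : Function.Injective f)

lemma push_δ (j : ℤ) : push f hf (δ j) = δ (f j) := by
  change (orthonormal_δ.comp f hf).orthogonalFamily.linearIsometry (lp.single 2 j (1 : ℂ)) = _
  rw [OrthogonalFamily.linearIsometry_apply_single]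
  simp

lemma star_push_mul_push : star (push f hf) * push f hf = 1 :=
  LinearIsometry.adjoint_comp_self _

lemma star_push_δ (j : ℤ) : star (push f hf) (δ (f j)) = δ j := by
  rw [← push_δ hf, ← mul_apply_eq_comp, star_push_mul_push,
    one_apply_eq_self]

lemma star_push_δ_of_notMem {k : ℤ} (hk : k ∉ Set.range f) : star (push f hf) (δ k) = 0 := by
  refine lp.ext (funext fun i => ?_)
  rw [← inner_δ, ContinuousLinearMap.star_eq_adjoint, ContinuousLinearMap.adjoint_inner_right,
    push_δ, inner_δ, δ_apply, if_neg]
  · rfl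
  · exact fun h => hk ⟨i, h⟩

lemma mul_injective (m : ℤ⁰) : Function.Injective fun j : ℤ => (m : ℤ) * j :=
  mul_right_injective₀ (nonZeroDivisors.coe_ne_zero m)

/-- The translation by `n`. -/
def u (n : ℤ) : EllTwo →L[ℂ] EllTwo := push (fun j => n + j) (add_right_injective n)

/-- The isometry induced by the multiplication by `m`. -/
def s (m : ℤ⁰) : EllTwo →L[ℂ] EllTwo := push (fun j => (m : ℤ) * j) (mul_injective m)

lemma u_δ (n j : ℤ) : u n (δ j) = δ (n + j) := push_δ _ j

lemma s_δ (m : ℤ⁰) (j : ℤ) : s m (δ j) = δ (m * j) := push_δ _ j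

lemma star_s_δ (m : ℤ⁰) (j : ℤ) : star (s m) (δ (m * j)) = δ j := star_push_δ (mul_injective m) j

lemma star_s_δ_of_not_dvd {m : ℤ⁰} {j : ℤ} (h : ¬ (m : ℤ) ∣ j) : star (s m) (δ j) = 0 :=
  star_push_δ_of_notMem (mul_injective m) fun ⟨i, hi⟩ => h ⟨i, hi.symm⟩

lemma u_mul (m n : ℤ) : u m * u n = u (m + n) := clm_ext fun j => by
  simp only [mul_apply_eq_comp, u_δ, add_assoc]

lemma star_u_mul (n : ℤ) : star (u n) * u n = 1 := star_push_mul_push _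

lemma u_zero : u 0 = 1 := clm_ext fun j => by simp [u_δ]

lemma star_u (n : ℤ) : star (u n) = u (-n) := by
  calc star (u n) = star (u n) * (u n * u (-n)) := by rw [u_mul, add_neg_cancel, u_zero, mul_one]
    _ = u (-n) := by rw [← mul_assoc, star_u_mul, one_mul]

/-- This is where projections become cosets: the operator is the orthogonal projection onto the
closed span of the basis vectors indexed by `n + (m)`. -/
lemma p_δ (n : ℤ) (m : ℤ⁰) (j : ℤ) :
    (u n * (s m * star (s m)) * u (-n)) (δ j) = if (m : ℤ) ∣ j - n then δ j else 0 := by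
  simp only [mul_apply_eq_comp, u_δ]
  split_ifs with h
  · obtain ⟨i, hi⟩ := h
    rw [show -n + j = m * i by rw [← hi]; ring, star_s_δ, s_δ, u_δ, ← hi, add_sub_cancel]
  · rw [star_s_δ_of_not_dvd, map_zero, map_zero]
    rwa [neg_add_eq_sub]

/-- The relations of `U[ℤ]` on `ℓ²(ℤ)`. -/
def fam : Family (EllTwo →L[ℂ] EllTwo) where
  u := u
  s := s
  u_unitary n := by
    rw [Unitary.mem_iff, star_u, u_mul, u_mul, neg_add_cancel, add_neg_cancel, u_zero]
    exact ⟨rfl, rfl⟩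
  s_isometry m := star_push_mul_push _
  s_mul m n := clm_ext fun j => by
    simp only [mul_apply_eq_comp, s_δ, Submonoid.coe_mul, mul_assoc]
  u_mul := u_mul
  s_mul_u m n := clm_ext fun j => by
    simp only [mul_apply_eq_comp, s_δ, u_δ, mul_add]
  sum_eq_one m := clm_ext fun j => by
    have hm : (m : ℤ) ≠ 0 := nonZeroDivisors.coe_ne_zero m
    have h0 := Int.emod_nonneg j hm
    -- On `δ j` only the coset of `j` contributes. Its representative `j % m` lies in `[0, |m|)` for
    -- negative `m` too.
    rw [sum_apply, Finset.sum_eq_single (j % m).toNat]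
    · rw [p_δ, Int.toNat_of_nonneg h0, if_pos (Int.dvd_self_sub_emod)]
      rfl
    · intro i hi hij
      rw [p_δ, if_neg]
      intro h
      apply hij
      rw [Finset.mem_range] at hi
      have h1 : (i : ℤ) % m = j % m := Int.modEq_iff_dvd.2 h
      have h2 : (i : ℤ) % m = i := by
        rw [← Int.emod_abs]
        refine Int.emod_eq_of_lt (Int.natCast_nonneg i) ?_
        rw [← Int.natCast_natAbs]
        exact_mod_cast hi
      rw [← h1, h2, Int.toNat_natCast]
    · intro h
      refine absurd (Finset.mem_range.2 ?_) h
      rw [← Int.ofNat_lt, Int.toNat_of_nonneg h0, Int.natCast_natAbs]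
      exact Int.emod_lt_abs j hm

end EllTwo

namespace UZ

/-- The representation of `U[ℤ]` on `ℓ²(ℤ)`. -/
def rep : UZ →⋆ₐ[ℂ] (EllTwo →L[ℂ] EllTwo) := (existsUnique_hom EllTwo.fam).choose

lemma rep_u (n : ℤ) : rep (gen.u n) = EllTwo.u n :=
  (existsUnique_hom EllTwo.fam).choose_spec.1.1 n

lemma rep_s (m : ℤ⁰) : rep (gen.s m) = EllTwo.s m :=
  (existsUnique_hom EllTwo.fam).choose_spec.1.2 m

lemma rep_p_δ (n : ℤ) (m : ℤ⁰) (j : ℤ) :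
    rep (gen.p n m) (EllTwo.δ j) = if (m : ℤ) ∣ j - n then EllTwo.δ j else 0 := by
  rw [Family.p, Family.e, map_mul, map_mul, map_mul, map_star, rep_u, rep_u, rep_s]
  exact EllTwo.p_δ n m j

/-- The universal algebra could a priori collapse; the representation shows that it does not, since
the projection fixes `δ n`. -/
lemma p_ne_zero (n : ℤ) (m : ℤ⁰) : gen.p n m ≠ 0 := fun h => by
  have h1 := rep_p_δ n m n
  rw [h, map_zero, sub_self, if_pos (dvd_zero _)] at h1
  exact EllTwo.δ_ne_zero n h1.symm

/-- The adjoint of a word is the partial affine map `j ↦ (m j - k) / n`. The adjoint is the useful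
side because a projection to the left of the word then acts on `δ j` first. -/
lemma rep_star_word_δ (m : ℤ⁰) (k : ℤ) (n : ℤ⁰) (j : ℤ) :
    rep (star (gen.word m k n).1) (EllTwo.δ j) = star (EllTwo.s n) (EllTwo.δ (-k + m * j)) := by
  change rep (star (star (gen.s m) * gen.u k * gen.s n)) (EllTwo.δ j) = _
  rw [star_mul, star_mul, star_star, gen.star_u, map_mul, map_mul, map_star, rep_s, rep_s, rep_u,
    mul_apply_eq_comp, mul_apply_eq_comp, EllTwo.s_δ, EllTwo.u_δ]

/-- Words that agree on a nonzero projection below their ranges have the same matrix. -/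
lemma frac_eq_of_p_mul_word {a : ℤ} {b m m' n n' : ℤ⁰} {k k' : ℤ}
    (h : gen.p a b * (gen.word m k n).1 = gen.p a b * (gen.word m' k' n').1)
    (hr : gen.p a b * ((gen.word m k n).1 * star (gen.word m k n).1) = gen.p a b) :
    (k : ℚ) / (m : ℤ) = k' / (m' : ℤ) ∧ ((n : ℤ) : ℚ) / (m : ℤ) = (n' : ℤ) / (m' : ℤ) := by
  have h1 := congrArg (fun x => rep (star x)) h
  have h2 := congrArg (fun x => rep (star x)) hr
  simp only [star_mul, star_star, gen.p_star, map_mul] at h1 h2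
  have hb : (b : ℤ) ≠ 0 := nonZeroDivisors.coe_ne_zero b
  have hm : (m : ℤ) ≠ 0 := nonZeroDivisors.coe_ne_zero m
  have hm' : (m' : ℤ) ≠ 0 := nonZeroDivisors.coe_ne_zero m'
  -- For `j` in the coset `a + (b)`, `hr` prevents the first partial map from killing `δ j`, and `h`
  -- forces the second one to send `j` to the same `i`.
  have key (j : ℤ) (hj : (b : ℤ) ∣ j - a) : ∃ i, -k + m * j = n * i ∧ -k' + m' * j = n' * i := by
    have e1 := congrArg (fun x => x (EllTwo.δ j)) h1
    have e2 := congrArg (fun x => x (EllTwo.δ j)) h2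
    simp only [mul_apply_eq_comp, rep_p_δ, if_pos hj, rep_star_word_δ] at e1 e2
    have hd : (n : ℤ) ∣ -k + m * j := by
      by_contra hc
      rw [EllTwo.star_s_δ_of_not_dvd hc, map_zero] at e2
      exact EllTwo.δ_ne_zero j e2.symm
    obtain ⟨i, hi⟩ := hd
    rw [hi, EllTwo.star_s_δ] at e1
    have hd' : (n' : ℤ) ∣ -k' + m' * j := by
      by_contra hc
      rw [EllTwo.star_s_δ_of_not_dvd hc] at e1
      exact EllTwo.δ_ne_zero i e1
    obtain ⟨i', hi'⟩ := hd'
    rw [hi', EllTwo.star_s_δ] at e1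
    exact ⟨i, hi, by rw [hi', EllTwo.δ_injective e1]⟩
  -- An affine map is determined by two points, here `a` and `a + b`.
  obtain ⟨i, hi, hi'⟩ := key a (by simp)
  obtain ⟨l, hl, hl'⟩ := key (a + b) (by simp)
  have g1 : (m : ℤ) * b = n * (l - i) := by linear_combination hl - hi
  have g2 : (m' : ℤ) * b = n' * (l - i) := by linear_combination hl' - hi'
  have hli : l - i ≠ 0 := fun h0 => mul_ne_zero hm hb (by rw [g1, h0, mul_zero])
  have g3 : (n : ℤ) * m' = n' * m := mul_right_cancel₀ hli (by
    linear_combination (m : ℤ) * g2 - (m' : ℤ) * g1)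
  have g4 : k * m' = k' * m := by linear_combination (m : ℤ) * hi' - (m' : ℤ) * hi - i * g3
  constructor
  · rw [div_eq_div_iff (by exact_mod_cast hm) (by exact_mod_cast hm')]
    exact_mod_cast g4
  · rw [div_eq_div_iff (by exact_mod_cast hm) (by exact_mod_cast hm')]
    exact_mod_cast g3

end UZ

/-! ### Arithmetic and topology of `ℤ̂` and `𝓡` -/

namespace ZHat

lemma cast_mul_apply (x : ZHat) (m k : ℕ+) : (x.1 (m * k)).cast = x.1 m := x.2 m k

lemma natCast_apply (n : ℕ) (m : ℕ+) : (n : ZHat).1 m = n := by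
  have : (n : ZHat).1 = (n : ∀ m : ℕ+, ZMod m) := map_natCast ZHat.subtype n
  rw [this]; rfl

lemma intCast_apply (n : ℤ) (m : ℕ+) : (n : ZHat).1 m = n := by
  have : (n : ZHat).1 = (n : ∀ m : ℕ+, ZMod m) := map_intCast ZHat.subtype n
  rw [this]; rfl

/-- An integer that represents `x` modulo `m`. -/
def residue (x : ZHat) (m : ℕ+) : ℕ := (x.1 m).val

lemma natCast_residue (x : ZHat) (m : ℕ+) : (residue x m : ZMod m) = x.1 m :=
  ZMod.natCast_zmod_val _

lemma natCast_residue_mul (x : ZHat) (m k : ℕ+) : (residue x (m * k) : ZMod m) = x.1 m := by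
  rw [← cast_mul_apply x m k, residue, ZMod.natCast_val]

/-- If `x` vanishes modulo `m`, its residue modulo `m k` is `m c_k` for every `k`. The `c_k` modulo
`k` are compatible, because a congruence modulo `m k` between multiples of `m` may be divided by
`m`; they form the quotient. -/
lemma dvd_iff (m : ℕ+) (x : ZHat) : (m : ZHat) ∣ x ↔ x.1 m = 0 := by
  constructor
  · rintro ⟨y, rfl⟩
    change (m : ZHat).1 m * y.1 m = 0
    rw [natCast_apply, ZMod.natCast_self, zero_mul]
  · intro h
    have hd (k : ℕ+) : (m : ℕ) ∣ residue x (m * k) := by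
      rw [← ZMod.natCast_eq_zero_iff, natCast_residue_mul, h]
    have hc (k : ℕ+) : ∃ c : ℕ, residue x (m * k) = m * c := hd k
    choose c hc using hc
    refine ⟨⟨fun k => c k, fun k l => ?_⟩, Subtype.ext (funext fun k => ?_)⟩
    · rw [map_natCast, ZMod.natCast_eq_natCast_iff]
      refine Nat.ModEq.mul_left_cancel' m.ne_zero ?_
      rw [← hc, ← hc, ← PNat.mul_coe, ← ZMod.natCast_eq_natCast_iff, natCast_residue, ← mul_assoc,
        natCast_residue_mul]
    · change x.1 k = (m : ZHat).1 k * (c k : ZMod k)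
      rw [natCast_apply, ← Nat.cast_mul, ← hc, mul_comm, natCast_residue_mul]

/-- Read at level `m k`, the hypothesis says that `m k` divides `m` times a residue of `x`, so `k`
divides this residue. Torsion-freeness makes the connecting maps of the inductive system injective.
-/
lemma natCast_mul_eq_zero (m : ℕ+) {x : ZHat} (h : (m : ZHat) * x = 0) : x = 0 := by
  refine Subtype.ext (funext fun k => ?_)
  change x.1 k = 0
  have h1 : (m : ZHat).1 (m * k) * x.1 (m * k) = 0 := congrArg (fun y : ZHat => y.1 (m * k)) h
  rw [natCast_apply, ← natCast_residue, ← Nat.cast_mul, ZMod.natCast_eq_zero_iff,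
    PNat.mul_coe] at h1
  have h2 := Nat.dvd_of_mul_dvd_mul_left m.pos h1
  rw [← natCast_residue_mul x k m, mul_comm k m, ZMod.natCast_eq_zero_iff]
  exact h2

lemma natCast_mul_injective (m : ℕ+) {x y : ZHat} (h : (m : ZHat) * x = m * y) : x = y :=
  sub_eq_zero.1 (natCast_mul_eq_zero m (by rw [mul_sub, h, sub_self]))

lemma dvd_sub_iff (m : ℕ+) (x y : ZHat) : (m : ZHat) ∣ x - y ↔ x.1 m = y.1 m := by
  rw [dvd_iff]
  exact sub_eq_zero

lemma dvd_sub_intCast_iff (m : ℕ+) (x : ZHat) (n : ℤ) : (m : ZHat) ∣ x - n ↔ x.1 m = n := by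
  rw [dvd_sub_iff, intCast_apply]

lemma dvd_sub_residue (m : ℕ+) (x : ZHat) : (m : ZHat) ∣ x - (residue x m : ℤ) := by
  rw [dvd_sub_intCast_iff, Int.cast_natCast, natCast_residue]

/-- The isometries are indexed by integers of either sign, the coordinates of `ℤ̂` by positive
integers; divisibility does not see the sign. -/
lemma exists_pnat (m : ℤ⁰) : ∃ l : ℕ+, ((m : ℤ) = l ∨ (m : ℤ) = -l) := by
  have hm : (m : ℤ) ≠ 0 := nonZeroDivisors.coe_ne_zero m
  obtain ⟨n, h⟩ := (m : ℤ).eq_nat_or_neg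
  exact ⟨⟨n, by omega⟩, h⟩

lemma intCast_dvd_iff {m : ℤ} {l : ℕ+} (h : m = l ∨ m = -l) (x : ZHat) :
    ((m : ℤ) : ZHat) ∣ x ↔ (l : ZHat) ∣ x := by
  rcases h with rfl | rfl <;> simp

lemma exists_dvd_sub (m : ℤ⁰) (x : ZHat) : ∃ n : ℤ, ((m : ℤ) : ZHat) ∣ x - n := by
  obtain ⟨l, h⟩ := exists_pnat m
  exact ⟨residue x l, (intCast_dvd_iff h _).2 (dvd_sub_residue l x)⟩

/-- Congruences between integer representatives can thus be verified inside `ℤ̂`, by comparing both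
with the same `r`. -/
lemma intCast_dvd_intCast {m : ℤ⁰} {n : ℤ} : ((m : ℤ) : ZHat) ∣ (n : ZHat) ↔ (m : ℤ) ∣ n := by
  obtain ⟨l, h⟩ := exists_pnat m
  rw [intCast_dvd_iff h, dvd_iff, intCast_apply, ZMod.intCast_zmod_eq_zero_iff_dvd]
  rcases h with h | h <;> simp [h]

lemma continuous_apply (m : ℕ+) : Continuous fun x : ZHat => x.1 m :=
  (_root_.continuous_apply m).comp continuous_subtype_val

lemma isClopen_dvd (m : ℤ⁰) (y : ZHat) : IsClopen {x : ZHat | ((m : ℤ) : ZHat) ∣ x - y} := by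
  obtain ⟨l, h⟩ := exists_pnat m
  simp only [intCast_dvd_iff h, dvd_sub_iff]
  exact (isClopen_discrete {y.1 l}).preimage (continuous_apply l)

lemma exists_dvd_subset {U : Set ZHat} (hU : IsOpen U) {x : ZHat} (hx : x ∈ U) :
    ∃ m : ℕ+, ∀ y : ZHat, (m : ZHat) ∣ y - x → y ∈ U := by
  obtain ⟨V, hV, rfl⟩ := isOpen_induced_iff.1 hU
  obtain ⟨I, v, hv, hI⟩ := isOpen_pi_iff.1 hV x.1 hx
  -- A basic neighbourhood restricts finitely many coordinates; congruence modulo the product of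
  -- their levels fixes all of them.
  refine ⟨∏ i ∈ I, i, fun y hy => hI fun i hi => ?_⟩
  have h1 : (i : ZHat) ∣ y - x := by
    obtain ⟨c, hc⟩ := Finset.dvd_prod_of_mem (fun i : ℕ+ => i) hi
    refine dvd_trans ⟨(c : ZHat), ?_⟩ hy
    rw [hc]; push_cast; rfl
  rw [dvd_sub_iff] at h1
  rw [h1]
  exact (hv i hi).2

/-- The compatibility conditions are closed, so Tychonoff applies to the product of the finite rings
`ℤ/(m)`. -/
instance : CompactSpace ZHat := by
  refine isCompact_iff_compactSpace.1 (IsClosed.isCompact ?_)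
  change IsClosed {r : ∀ m : ℕ+, ZMod m | ∀ m k : ℕ+, _ = _}
  simp only [Set.ofPred_forall]
  refine isClosed_iInter fun m => isClosed_iInter fun k => isClosed_eq ?_ (_root_.continuous_apply m)
  exact continuous_of_discreteTopology.comp (_root_.continuous_apply (m * k))

end ZHat

/-! ### The inductive limit `𝓡` and the open embedding of `ℤ̂`. -/

namespace RLim

/-- Torsion-freeness cancels the auxiliary multipliers in the limit relation, and equality becomes
that of the fractions `x/p` and `y/q`. -/
lemma mk_eq_mk_iff (p q : ℕ+) (x y : ZHat) : mk p x = mk q y ↔ (q : ZHat) * x = p * y := by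
  constructor
  · intro h
    obtain ⟨k, l, h1, h2⟩ := Quotient.exact h
    dsimp only at h1 h2
    have h3 : (p : ZHat) * k = q * l := by
      exact_mod_cast congrArg (fun t : ℕ+ => ((t : ℕ) : ZHat)) h1
    exact ZHat.natCast_mul_injective k (by linear_combination (q : ZHat) * h2 - y * h3)
  · intro h
    exact Quotient.sound ⟨q, p, mul_comm _ _, h⟩

lemma incl_injective : Function.Injective incl := fun x y h => by
  simpa using (mk_eq_mk_iff 1 1 x y).1 h

lemma continuous_mk (p : ℕ+) : Continuous (mk p) :=
  continuous_quotient_mk'.comp (continuous_sigmaMk (σ := fun _ : ℕ+ => ZHat))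

lemma isOpen_iff {U : Set RLim} : IsOpen U ↔ ∀ p, IsOpen (mk p ⁻¹' U) := by
  change IsOpen (Quotient.mk limSetoid ⁻¹' U) ↔ _
  rw [isOpen_sigma_iff]
  rfl

lemma continuous_iff {X : Type*} [TopologicalSpace X] {f : RLim → X} :
    Continuous f ↔ ∀ p, Continuous fun x => f (mk p x) := by
  simp only [continuous_def, isOpen_iff]
  exact ⟨fun h p U hU => h U hU p, fun h U hU p => h p U hU⟩

/-- In `𝓡_p` the subset `ℤ̂` appears as `p ℤ̂`. If `p r` is a point of the preimage and `U` contains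
all points congruent to `r` modulo `m`, then the preimage contains the open coset of `p r` modulo `p
m`. -/
lemma isOpenMap_incl : IsOpenMap incl := by
  intro U hU
  rw [isOpen_iff]
  intro p
  rw [isOpen_iff_forall_mem_open]
  rintro x ⟨r, hr, hx⟩
  obtain ⟨m, hm⟩ := ZHat.exists_dvd_subset hU hr
  have hx' : (p : ZHat) * r = x := by simpa using (mk_eq_mk_iff 1 p r x).1 hx
  refine ⟨{z | ((nz (p * m) : ℤ) : ZHat) ∣ z - x}, ?_, (ZHat.isClopen_dvd _ _).isOpen, ?_⟩
  · rintro z ⟨t, ht⟩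
    refine ⟨r + m * t, hm _ ⟨t, by ring⟩, ?_⟩
    refine (mk_eq_mk_iff _ _ _ _).2 ?_
    rw [← hx', nz] at ht
    push_cast at ht ⊢
    linear_combination -ht
  · simp

lemma isEmbedding_incl : Topology.IsEmbedding incl :=
  (Topology.IsOpenEmbedding.of_continuous_injective_isOpenMap (continuous_mk 1) incl_injective
    isOpenMap_incl).isEmbedding

instance : ContinuousConstSMul PQ RLim where
  continuous_const_smul g := by
    obtain ⟨d, n, m, hb, ha⟩ := exists_rep g
    rw [continuous_iff]
    intro p
    simp only [smul_mk g d n m hb ha]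
    exact (continuous_mk _).comp (by fun_prop)

end RLim

/-! ### Matrices of `P_ℚ` as fractions, and their action on `ℤ̂`. -/

namespace PQ

lemma ext {g h : PQ} (hb : g.b = h.b) (ha : g.a = h.a) : g = h := by
  refine Subtype.ext (Units.ext (Matrix.ext fun i j => ?_))
  fin_cases i <;> fin_cases j
  · exact g.2.1.trans h.2.1.symm
  · exact g.2.2.trans h.2.2.symm
  · exact hb
  · exact ha

lemma b_mk (b a : ℚ) (ha : a ≠ 0) : (mk b a ha).b = b := by
  simp [mk, PQ.b, Matrix.GeneralLinearGroup.mkOfDetNeZero]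

lemma a_mk (b a : ℚ) (ha : a ≠ 0) : (mk b a ha).a = a := by
  simp [mk, PQ.a, Matrix.GeneralLinearGroup.mkOfDetNeZero]

lemma b_frac (k : ℤ) (n m : ℤ⁰) : (frac k n m).b = (k : ℚ) / (m : ℤ) := b_mk _ _ _

lemma a_frac (k : ℤ) (n m : ℤ⁰) : (frac k n m).a = ((n : ℤ) : ℚ) / (m : ℤ) := a_mk _ _ _

lemma a_ne_zero (g : PQ) : g.a ≠ 0 := fun h => by
  have h1 := a_mul g g⁻¹
  rw [mul_inv_cancel, a_one, h, zero_mul] at h1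
  exact one_ne_zero h1

lemma exists_frac (g : PQ) : ∃ (k : ℤ) (n m : ℤ⁰), frac k n m = g := by
  obtain ⟨d, k, n, hb, ha⟩ := RLim.exists_rep g
  have hn : n ≠ 0 := by
    rintro rfl
    exact g.a_ne_zero (by simpa using ha)
  refine ⟨k, ⟨n, mem_nonZeroDivisors_of_ne_zero hn⟩, nz d, ext ?_ ?_⟩
  · rw [b_frac, hb]; simp [nz]
  · rw [a_frac, ha]; simp [nz]

lemma frac_eq_frac_iff (k k' : ℤ) (n m n' m' : ℤ⁰) :
    frac k n m = frac k' n' m' ↔ k * m' = k' * m ∧ n * m' = n' * m := by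
  have hm : ((m : ℤ) : ℚ) ≠ 0 := Int.cast_ne_zero.2 (nonZeroDivisors.coe_ne_zero m)
  have hm' : ((m' : ℤ) : ℚ) ≠ 0 := Int.cast_ne_zero.2 (nonZeroDivisors.coe_ne_zero m')
  have h : frac k n m = frac k' n' m' ↔
      (k : ℚ) / (m : ℤ) = k' / (m' : ℤ) ∧ ((n : ℤ) : ℚ) / (m : ℤ) = (n' : ℤ) / (m' : ℤ) := by
    rw [← b_frac k n, ← b_frac k' n', ← a_frac k, ← a_frac k']
    exact ⟨fun h => by rw [h]; exact ⟨rfl, rfl⟩, fun h => ext h.1 h.2⟩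
  rw [h, div_eq_div_iff hm hm', div_eq_div_iff hm hm', ← Subtype.coe_inj, Submonoid.coe_mul,
    Submonoid.coe_mul]
  norm_cast

lemma frac_mul_frac (k k' : ℤ) (n m n' m' : ℤ⁰) :
    frac k n m * frac k' n' m' = frac (m' * k + n * k') (n * n') (m * m') := by
  have hm : ((m : ℤ) : ℚ) ≠ 0 := Int.cast_ne_zero.2 (nonZeroDivisors.coe_ne_zero m)
  have hm' : ((m' : ℤ) : ℚ) ≠ 0 := Int.cast_ne_zero.2 (nonZeroDivisors.coe_ne_zero m')
  refine ext ?_ ?_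
  · rw [b_mul]
    simp only [b_frac, a_frac, Submonoid.coe_mul]
    push_cast
    field_simp
  · rw [a_mul]
    simp only [a_frac, Submonoid.coe_mul]
    push_cast
    field_simp

lemma frac_one : frac 0 1 1 = 1 := by
  refine ext ?_ ?_
  · rw [b_frac, b_one]; simp
  · rw [a_frac, a_one]; simp

lemma frac_inv (k : ℤ) (n m : ℤ⁰) : (frac k n m)⁻¹ = frac (-k) m n := by
  refine inv_eq_of_mul_eq_one_right ?_
  rw [frac_mul_frac, ← frac_one, frac_eq_frac_iff]
  constructor
  · simp [mul_comm]
  · simp [mul_comm]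

/-- Clearing denominators replaces the action on `𝓡` by an equation in `ℤ̂`, the form in which words
act on the characters `ξ_r`. -/
lemma incl_eq_frac_smul_iff (r r' : ZHat) (k : ℤ) (n m : ℤ⁰) :
    RLim.incl r = frac k n m • RLim.incl r' ↔
      ((m : ℤ) : ZHat) * r = ((n : ℤ) : ZHat) * r' + k := by
  obtain ⟨l, h⟩ := ZHat.exists_pnat m
  rcases h with h | h
  · rw [RLim.incl, RLim.incl, RLim.smul_mk _ l k n (by rw [b_frac, h]; simp)
      (by rw [a_frac, h]; simp), RLim.mk_eq_mk_iff, h]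
    simp
  -- The action formula wants a positive denominator, so for `m = -l` both numerators change sign.
  · rw [RLim.incl, RLim.incl, RLim.smul_mk _ l (-k) (-n) (by rw [b_frac, h]; simp [div_neg, neg_div])
      (by rw [a_frac, h]; simp [div_neg, neg_div]), RLim.mk_eq_mk_iff, h]
    simp only [mul_one, PNat.one_coe, Nat.cast_one, one_mul, Int.cast_neg, Int.cast_natCast]
    constructor <;> intro h <;> linear_combination -h

end PQ

/-! ### Words and projections of `T` -/

namespace Family

variable {A : Type*} [CStarAlgebra A] (F : Family A)

lemma star_s_mul_s_mul (m : ℤ⁰) (x : A) : star (F.s m) * (F.s m * x) = x := by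
  rw [← mul_assoc, F.s_isometry, one_mul]

lemma u_mul_u_mul (a b : ℤ) (x : A) : F.u a * (F.u b * x) = F.u (a + b) * x := by
  rw [← mul_assoc, F.u_mul]

lemma star_s_mul_e (m : ℤ⁰) : star (F.s m) * F.e m = star (F.s m) := by
  rw [e, ← mul_assoc, F.s_isometry, one_mul]

lemma s_mul_star_s (m k : ℤ⁰) : F.s m * star (F.s k) = F.e m * star (F.s k) * F.s m := by
  have h : star (F.s m) * star (F.s k) = star (F.s k) * star (F.s m) := by
    rw [← star_mul, ← star_mul, s_mul, s_mul, mul_comm]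
  rw [e, mul_assoc (F.s m), h, mul_assoc, mul_assoc, F.s_isometry, mul_one]

lemma s_p_s (m : ℤ⁰) (n : ℤ) (k : ℤ⁰) :
    F.s m * F.p n k * star (F.s m) = F.p (m * n) (m * k) := by
  rw [p, p, ← s_e_s, ← mul_neg]
  simp only [mul_assoc]
  rw [star_s_mul_u, ← mul_assoc, s_mul_u]
  simp only [mul_assoc]

lemma star_s_p_s (m : ℤ⁰) (n : ℤ) (k : ℤ⁰) :
    star (F.s m) * F.p (m * n) (m * k) * F.s m = F.p n k := by
  rw [← s_p_s]
  simp only [mul_assoc, star_s_mul_s_mul, F.s_isometry, mul_one]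

lemma p_mem_P (n : ℤ) (m : ℤ⁰) : F.p n m ∈ F.P := Or.inl ⟨n, m, rfl⟩

/-- The order of projections is containment of cosets, here `a + (d) ⊆ b + (c)`. -/
lemma p_mul_p_of_dvd {a b : ℤ} {c d : ℤ⁰} (hc : c ∣ d) (h : (c : ℤ) ∣ a - b) :
    F.p a d * F.p b c = F.p a d := by
  obtain ⟨k, rfl⟩ := hc
  rw [F.p_congr (Int.modEq_iff_dvd.2 h : b ≡ a [ZMOD c]), p_mul_p_left]

lemma p_mul_p_eq_zero {a b : ℤ} {c : ℤ⁰} (h : ¬ (c : ℤ) ∣ a - b) : F.p a c * F.p b c = 0 :=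
  F.p_orth c fun h' => h (Int.modEq_iff_dvd.1 h'.symm)

lemma p_one (n : ℤ) : F.p n 1 = 1 := by rw [p, e_one, mul_one, u_mul_neg]

lemma coe_word (m : ℤ⁰) (k : ℤ) (n : ℤ⁰) :
    (F.word m k n : A) = star (F.s m) * F.u k * F.s n := rfl

lemma coe_proj (n : ℤ) (m : ℤ⁰) : ((F.proj n m).1 : A) = F.p n m := rfl

lemma coe_T_mul (x y : F.T) : ((x * y : F.T) : A) = x * y := rfl

lemma coe_T_star (x : F.T) : ((star x : F.T) : A) = star (x : A) := rfl

lemma proj_ext {e f : Proj F.T} (h : (e.1 : A) = f.1) : e = f := Subtype.ext (Subtype.ext h)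

lemma coe_proj_mul (e f : Proj F.T) : ((e * f).1 : A) = e.1 * f.1 := rfl

lemma coe_conj (t : F.T) (e : Proj F.T) : ((Proj.conj t e).1 : A) = t * e.1 * star (t : A) := rfl

lemma coe_range (t : F.T) : ((Proj.range t).1 : A) = t * star (t : A) := rfl

/-- Since `u^{lk} s_l = s_l u^k`, the isometry `s_l` cancels against its adjoint. Hence a word
depends only on the fractions `k/m` and `n/m`. -/
lemma word_scale (l m : ℤ⁰) (k : ℤ) (n : ℤ⁰) :
    F.word (l * m) (l * k) (l * n) = F.word m k n := by
  refine Subtype.ext ?_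
  rw [coe_word, coe_word, ← s_mul, ← s_mul, star_mul]
  simp only [mul_assoc]
  rw [← mul_assoc (F.u _), ← s_mul_u, mul_assoc, star_s_mul_s_mul]

lemma star_word (m : ℤ⁰) (k : ℤ) (n : ℤ⁰) : star (F.word m k n) = F.word n (-k) m := by
  refine Subtype.ext ?_
  rw [coe_T_star, coe_word, coe_word, star_mul, star_mul, star_star, star_u, mul_assoc]

lemma word_one : (F.word 1 0 1 : A) = 1 := by
  rw [coe_word, s_one, u_zero, star_one, one_mul, one_mul]

lemma coe_conj_word (m : ℤ⁰) (k : ℤ) (n : ℤ⁰) (a : ℤ) (b : ℤ⁰) :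
    ((Proj.conj (F.word m k n) (F.proj a b)).1 : A) =
      star (F.s m) * F.p (k + n * a) (n * b) * F.s m := by
  rw [coe_conj, coe_word, coe_proj, ← u_p_u, ← s_p_s]
  simp only [star_mul, star_star, star_u, mul_assoc]

/-- The affine image of the coset `a + (b)` is split off, so that only conjugation by `s_m^*`
remains to be evaluated on `ξ_r`. -/
lemma conj_word (m : ℤ⁰) (k : ℤ) (n : ℤ⁰) (a : ℤ) (b : ℤ⁰) :
    Proj.conj (F.word m k n) (F.proj a b) =
      Proj.conj (F.word m 0 1) (F.proj (k + n * a) (n * b)) := by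
  refine F.proj_ext ?_
  rw [coe_conj_word, coe_conj_word]
  simp

lemma range_eq_conj (t : F.T) : Proj.range t = Proj.conj t (F.proj 0 1) := by
  refine F.proj_ext ?_
  rw [coe_range, coe_conj, coe_proj, p_one, mul_one]

lemma coe_range_word (m : ℤ⁰) (k : ℤ) (n : ℤ⁰) :
    ((Proj.range (F.word m k n)).1 : A) = star (F.s m) * F.p k n * F.s m := by
  rw [range_eq_conj, coe_conj_word, mul_zero, add_zero, mul_one]

lemma range_word (m : ℤ⁰) (k : ℤ) (n : ℤ⁰) :
    Proj.range (F.word m k n) = Proj.conj (F.word m 0 1) (F.proj k n) := by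
  rw [range_eq_conj, conj_word, mul_zero, add_zero, mul_one]

/-- The factor `e_m` commutes with the projection and is absorbed by `s_m^*`. -/
lemma star_s_mul_p_mul (m : ℤ⁰) (k : ℤ) (n : ℤ⁰) (x : A) :
    star (F.s m) * (F.p k n * (F.s m * (star (F.s m) * x))) = star (F.s m) * (F.p k n * x) := by
  have h : F.p k n * F.e m = F.e m * F.p k n := F.comm_of_mem_P (F.p_mem_P k n) (F.e_mem_P m)
  calc _ = star (F.s m) * (F.p k n * F.e m) * x := by simp only [e, mul_assoc]
    _ = (star (F.s m) * F.e m) * F.p k n * x := by rw [h]; simp only [mul_assoc]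
    _ = _ := by rw [star_s_mul_e, mul_assoc]

/-- Passing `s_n` to the right of `s_{m'}^*` costs a factor `e_n`. Moved to the left of `u^k`, it
becomes `u^k e_n u^{-k}`, which accounts for the range projection of the first word; the other
factors collect to the word of the matrix product. -/
lemma word_mul_word (m : ℤ⁰) (k : ℤ) (n m' : ℤ⁰) (k' : ℤ) (n' : ℤ⁰) :
    F.word m k n * F.word m' k' n' =
      (Proj.range (F.word m k n)).1 * F.word (m * m') (m' * k + n * k') (n * n') := by
  refine Subtype.ext ?_
  rw [coe_T_mul, coe_T_mul, coe_range_word]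
  simp only [coe_word]
  have h1 : star (F.s (m * m')) = star (F.s m) * star (F.s m') := by
    rw [mul_comm, ← s_mul, star_mul]
  have h2 : F.u k * F.e n = F.p k n * F.u k := by
    simp only [p, mul_assoc, u_neg_mul, mul_one]
  rw [h1]
  simp only [mul_assoc]
  rw [star_s_mul_p_mul]
  calc _ = star (F.s m) * (F.u k * ((F.s n * star (F.s m')) * (F.u k' * F.s n'))) := by
        simp only [mul_assoc]
    _ = star (F.s m) * ((F.u k * F.e n) * (star (F.s m') * ((F.s n * F.u k') * F.s n'))) := by
        rw [s_mul_star_s]; simp only [mul_assoc]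
    _ = star (F.s m) * (F.p k n * ((F.u k * star (F.s m')) *
          (F.u (n * k') * (F.s n * F.s n')))) := by
        rw [h2, s_mul_u]; simp only [mul_assoc]
    _ = _ := by
        rw [star_s_mul_u, s_mul, mul_assoc, u_mul_u_mul]

/-- Every element of `T` is the product of a projection and a word. -/
lemma exists_eq_proj_mul_word (t : F.T) : ∃ (q : Proj F.T) (m : ℤ⁰) (k : ℤ) (n : ℤ⁰),
    t = q.1 * F.word m k n := by
  rcases t with ⟨t, ⟨m, n, c, a, b, rfl⟩ | ht⟩
  -- The projection is `s_m^* u^a e_c u^{-a} s_m`; multiplied by `s_m^* u^{a+b} s_n` it restores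
  -- `s_m^* u^a e_c u^b s_n`.
  · refine ⟨Proj.range (F.word m a c), m, a + b, n, Subtype.ext ?_⟩
    rw [coe_T_mul, coe_range_word, coe_word]
    simp only [mul_assoc]
    rw [star_s_mul_p_mul, p]
    simp only [mul_assoc, u_mul_u_mul, neg_add_cancel_left]
  · refine ⟨0, 1, 0, 1, Subtype.ext ?_⟩
    exact (Set.mem_singleton_iff.1 ht).trans (zero_mul _).symm

/-- A projection equals `e e^*`, and every `t t^*` with `t` in `T` lies in `P`. -/
lemma eq_zero_or_eq_proj (e : Proj F.T) : e = 0 ∨ ∃ n m, e = F.proj n m := by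
  have h : (e.1 : A) ∈ F.P := by
    have h1 := F.mul_star_mem_P e.1.2
    have h2 : (e.1 : A) * star (e.1 : A) = e.1 :=
      congrArg Subtype.val (congrArg Subtype.val (Proj.range_proj e))
    rwa [h2] at h1
  rcases h with ⟨n, m, h⟩ | h
  · exact Or.inr ⟨n, m, F.proj_ext h⟩
  · exact Or.inl (F.proj_ext h)

end Family

/-! ### The characters `ξ_r` -/

namespace Proj

variable {S : Type*} [SemigroupWithZero S] [StarMul S] [IsInverseSemigroup S]

instance : CommSemigroup (Proj S) where
  mul_assoc _ _ _ := Subtype.ext (mul_assoc _ _ _)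
  mul_comm e f := Subtype.ext (e.comm f)

lemma mul_self (e : Proj S) : e * e = e := Subtype.ext e.sq

end Proj

namespace Character

variable {S : Type*} [SemigroupWithZero S] [StarMul S] [IsInverseSemigroup S]

lemma apply_of_mul_eq {x : Character S} {e f : Proj S} (he : x e = true) (h : e * f = e) :
    x f = true := by
  have h1 := x.map_mul e f
  rw [h, he, Bool.true_and] at h1
  exact h1.symm

lemma ne_zero_of_apply {x : Character S} {e : Proj S} (he : x e = true) : e ≠ 0 := by
  rintro rfl
  rw [map_zero] at he
  exact Bool.false_ne_true he

lemma continuous_eval (e : Proj S) : Continuous fun x : Character S => x e :=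
  (continuous_apply e).comp continuous_induced_dom

lemma isOpen_eval (e : Proj S) : IsOpen {x : Character S | x e = true} :=
  (isOpen_discrete {true}).preimage (continuous_eval e)

instance : T2Space (Character S) :=
  T2Space.of_injective_continuous (f := fun x : Character S => x.toFun)
    (fun _ _ h => Character.ext fun e => congrFun h e) continuous_induced_dom

end Character

open Character

lemma proj_mul_proj_of_dvd {a b : ℤ} {c d : ℤ⁰} (hc : c ∣ d) (h : (c : ℤ) ∣ a - b) :
    UZ.gen.proj a d * UZ.gen.proj b c = UZ.gen.proj a d :=
  UZ.gen.proj_ext (UZ.gen.p_mul_p_of_dvd hc h)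

lemma proj_mul_proj_eq_zero {a b : ℤ} {c : ℤ⁰} (h : ¬ (c : ℤ) ∣ a - b) :
    UZ.gen.proj a c * UZ.gen.proj b c = 0 :=
  UZ.gen.proj_ext (UZ.gen.p_mul_p_eq_zero h)

lemma proj_ne_zero (n : ℤ) (m : ℤ⁰) : UZ.gen.proj n m ≠ 0 := fun h =>
  UZ.p_ne_zero n m (congrArg (fun e : Proj TZ => (e.1 : UZ)) h)

/-- Two projections that contain cosets of `r` contain a common coset of `r`. -/
lemma exists_common_proj (r : ZHat) {a b : ℤ} {c d : ℤ⁰} (hc : ((c : ℤ) : ZHat) ∣ r - a)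
    (hd : ((d : ℤ) : ZHat) ∣ r - b) : ∃ n : ℤ, (((c * d : ℤ⁰) : ℤ) : ZHat) ∣ r - n ∧
      UZ.gen.proj n (c * d) * UZ.gen.proj a c = UZ.gen.proj n (c * d) ∧
      UZ.gen.proj n (c * d) * UZ.gen.proj b d = UZ.gen.proj n (c * d) := by
  -- Any integer `n` congruent to `r` modulo `c d` serves: through `r` it is congruent to `a` modulo
  -- `c` and to `b` modulo `d`.
  obtain ⟨n, hn⟩ := ZHat.exists_dvd_sub (c * d) r
  have key {a : ℤ} {c' : ℤ⁰} (h : c' ∣ c * d) (ha : ((c' : ℤ) : ZHat) ∣ r - a) :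
      (c' : ℤ) ∣ n - a := by
    rw [← ZHat.intCast_dvd_intCast]
    have h1 : ((c' : ℤ) : ZHat) ∣ r - n := by
      obtain ⟨k, hk⟩ := h
      exact dvd_trans ⟨((k : ℤ) : ZHat), by rw [hk, Submonoid.coe_mul, Int.cast_mul]⟩ hn
    have h2 := dvd_sub ha h1
    push_cast
    rwa [sub_sub_sub_cancel_left] at h2
  exact ⟨n, hn, proj_mul_proj_of_dvd (dvd_mul_right c d) (key (dvd_mul_right c d) hc),
    proj_mul_proj_of_dvd (dvd_mul_left d c) (key (dvd_mul_left d c) hd)⟩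

open Classical in
/-- The character `ξ_r`. -/
def xi (r : ZHat) : Character TZ where
  -- The support is the filter generated by the cosets of `r`. Multiplicativity is then the fact
  -- that two such cosets contain a common third one.
  toFun e := decide (∃ (n : ℤ) (m : ℤ⁰), ((m : ℤ) : ZHat) ∣ r - n ∧
    UZ.gen.proj n m * e = UZ.gen.proj n m)
  map_mul e f := by
    rw [← Bool.decide_and, decide_eq_decide]
    constructor
    · rintro ⟨n, m, h, h'⟩
      refine ⟨⟨n, m, h, ?_⟩, ⟨n, m, h, ?_⟩⟩
      · rw [← h', mul_assoc, mul_assoc, mul_comm f, ← mul_assoc e, Proj.mul_self]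
      · rw [← h', mul_assoc, mul_assoc, Proj.mul_self]
    · rintro ⟨⟨a, c, hc, hc'⟩, ⟨b, d, hd, hd'⟩⟩
      obtain ⟨n, hn, h1, h2⟩ := exists_common_proj r hc hd
      refine ⟨n, c * d, hn, ?_⟩
      rw [← h1, ← mul_assoc, mul_assoc _ _ e, hc', h1, ← h2, mul_assoc, hd', h2]
  map_zero := by
    rw [decide_eq_false_iff_not]
    rintro ⟨n, m, -, h⟩
    refine proj_ne_zero n m (h.symm.trans (Subtype.ext ?_))
    exact mul_zero _
  nonzero := by
    obtain ⟨n, hn⟩ := ZHat.exists_dvd_sub 1 r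
    exact ⟨UZ.gen.proj n 1, decide_eq_true ⟨n, 1, hn, Proj.mul_self _⟩⟩

lemma xi_eq_true_iff (r : ZHat) (e : Proj TZ) : xi r e = true ↔ ∃ (n : ℤ) (m : ℤ⁰),
    ((m : ℤ) : ZHat) ∣ r - n ∧ UZ.gen.proj n m * e = UZ.gen.proj n m := by
  simp [xi]

lemma xi_proj (r : ZHat) (n : ℤ) (m : ℤ⁰) :
    xi r (UZ.gen.proj n m) = true ↔ ((m : ℤ) : ZHat) ∣ r - n := by
  constructor
  · intro h
    obtain ⟨a, ha⟩ := ZHat.exists_dvd_sub m r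
    have h1 : xi r (UZ.gen.proj a m) = true :=
      (xi_eq_true_iff _ _).2 ⟨a, m, ha, Proj.mul_self _⟩
    have h2 : xi r (UZ.gen.proj a m * UZ.gen.proj n m) = true := by
      rw [Character.map_mul, h1, h]; rfl
    -- The coset `a + (m)` of `r` and `n + (m)` both lie in the support; were they different, their
    -- product would be zero.
    by_contra hc
    refine ne_zero_of_apply h2 (proj_mul_proj_eq_zero fun hd => hc ?_)
    rw [← ZHat.intCast_dvd_intCast] at hd
    push_cast at hd
    simpa using dvd_add ha hd
  · exact fun h => (xi_eq_true_iff _ _).2 ⟨n, m, h, Proj.mul_self _⟩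

lemma isXi_xi (r : ZHat) : IsXi r (xi r) := fun n m => by
  rw [xi_proj, ← ZHat.dvd_sub_intCast_iff]
  simp [nz]

/-- The character `ξ_r` is determined by the cosets that contain `r`. -/
lemma eq_xi {y : Character TZ} {r : ZHat} (h : ∀ (n : ℤ) (m : ℤ⁰), ((m : ℤ) : ZHat) ∣ r - n →
    y (UZ.gen.proj n m) = true) : y = xi r := by
  refine Character.ext fun e => Bool.eq_iff_iff.2 ⟨fun he => ?_, fun he => ?_⟩
  · rcases UZ.gen.eq_zero_or_eq_proj e with rfl | ⟨n, m, rfl⟩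
    · exact absurd rfl (ne_zero_of_apply he)
    -- The support of `y` contains the coset of `r` modulo `m`, so it contains no other coset modulo
    -- `m`.
    · obtain ⟨a, ha⟩ := ZHat.exists_dvd_sub m r
      have h2 : y (UZ.gen.proj a m * UZ.gen.proj n m) = true := by
        rw [Character.map_mul, h a m ha, he]; rfl
      rw [xi_proj]
      by_contra hc
      refine ne_zero_of_apply h2 (proj_mul_proj_eq_zero fun hd => hc ?_)
      rw [← ZHat.intCast_dvd_intCast] at hd
      push_cast at hd
      simpa using dvd_add ha hd
  · obtain ⟨n, m, hn, hm⟩ := (xi_eq_true_iff r e).1 he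
    exact apply_of_mul_eq (h n m hn) hm

lemma xi_injective : Function.Injective xi := fun r r' h => by
  refine Subtype.ext (funext fun m => ?_)
  have h1 := (isXi_xi r (ZHat.residue r m) m).2 (by
    rw [Int.cast_natCast, ZHat.natCast_residue])
  rw [h, isXi_xi r' _ m, Int.cast_natCast, ZHat.natCast_residue] at h1
  exact h1.symm

/-- For a coset `a + (d)` of `r`, multiplication by `m` gives `m a + (m d) ⊆ c + (d)`. Conjugating
this containment back by `s_m^*` puts the coset of `r` below the projection in question. -/
lemma xi_conj_word_of_dvd {r : ZHat} {m : ℤ⁰} {c : ℤ} {d : ℤ⁰}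
    (h : ((d : ℤ) : ZHat) ∣ ((m : ℤ) : ZHat) * r - c) :
    xi r (Proj.conj (UZ.gen.word m 0 1) (UZ.gen.proj c d)) = true := by
  obtain ⟨a, ha⟩ := ZHat.exists_dvd_sub d r
  refine (xi_eq_true_iff _ _).2 ⟨a, d, ha, UZ.gen.proj_ext ?_⟩
  have h1 : (d : ℤ) ∣ m * a - c := by
    rw [← ZHat.intCast_dvd_intCast]
    have := dvd_sub h (ha.mul_left ((m : ℤ) : ZHat))
    push_cast
    convert this using 1
    ring
  rw [UZ.gen.coe_proj_mul, UZ.gen.coe_conj_word, UZ.gen.coe_proj]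
  simp only [Submonoid.coe_one, one_mul, zero_add]
  calc _ = star (UZ.gen.s m) * (UZ.gen.p (m * a) (m * d) * UZ.gen.e m * UZ.gen.p c d) *
        UZ.gen.s m := by
        rw [← UZ.gen.star_s_p_s m a d]
        simp only [Family.e, mul_assoc]
    _ = star (UZ.gen.s m) * (UZ.gen.p (m * a) (m * d) * UZ.gen.p c d) * UZ.gen.s m := by
        rw [← UZ.gen.p_zero, UZ.gen.p_mul_p_of_dvd (dvd_mul_right m d) (by simp)]
    _ = _ := by
        rw [UZ.gen.p_mul_p_of_dvd (dvd_mul_left d m) h1, UZ.gen.star_s_p_s]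

/-- One implication suffices: the translated character is `1` on all cosets of `m r`, and by `eq_xi`
this determines it. -/
lemma xi_conj_word (r : ZHat) (m : ℤ⁰) (e : Proj TZ) :
    xi r (Proj.conj (UZ.gen.word m 0 1) e) = xi (((m : ℤ) : ZHat) * r) e := by
  have h : xi r (Proj.range (UZ.gen.word m 0 1)) = true := by
    rw [UZ.gen.range_eq_conj]
    exact xi_conj_word_of_dvd (by simp)
  have h1 : (xi r).act (UZ.gen.word m 0 1) h = xi (((m : ℤ) : ZHat) * r) :=
    eq_xi fun n k hk => xi_conj_word_of_dvd hk
  rw [← h1]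
  rfl

lemma xi_range_word {r r' : ZHat} {m n : ℤ⁰} {k : ℤ}
    (h : ((m : ℤ) : ZHat) * r = ((n : ℤ) : ZHat) * r' + k) :
    xi r (Proj.range (UZ.gen.word m k n)) = true := by
  rw [UZ.gen.range_word, xi_conj_word, xi_proj, h, add_sub_cancel_right]
  exact dvd_mul_right _ _

/-- The domain condition is `m r ∈ k + n ℤ̂`; the quotient `r'` gives the source of the germ. -/
lemma exists_of_xi_range_word {r : ZHat} {m n : ℤ⁰} {k : ℤ}
    (h : xi r (Proj.range (UZ.gen.word m k n)) = true) :
    ∃ r' : ZHat, ((m : ℤ) : ZHat) * r = ((n : ℤ) : ZHat) * r' + k := by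
  rw [UZ.gen.range_word, xi_conj_word, xi_proj] at h
  obtain ⟨r', hr'⟩ := h
  exact ⟨r', by rw [← hr', sub_add_cancel]⟩

lemma act_xi_word {r r' : ZHat} {m n : ℤ⁰} {k : ℤ}
    (h : ((m : ℤ) : ZHat) * r = ((n : ℤ) : ZHat) * r' + k)
    (hw : xi r (Proj.range (UZ.gen.word m k n)) = true) :
    (xi r).act (UZ.gen.word m k n) hw = xi r' := by
  refine eq_xi fun a b hb => ?_
  change xi r (Proj.conj (UZ.gen.word m k n) (UZ.gen.proj a b)) = true
  rw [UZ.gen.conj_word, xi_conj_word, xi_proj, h]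
  push_cast
  convert mul_dvd_mul_left (((n : ℤ) : ZHat)) hb using 1
  ring

/-! ### The tight spectrum of `T` -/

lemma continuous_xi : Continuous xi := by
  refine continuous_induced_rng.2 (continuous_pi fun e => ?_)
  change Continuous fun r => xi r e
  rw [continuous_bool_rng true]
  rcases UZ.gen.eq_zero_or_eq_proj e with rfl | ⟨n, m, rfl⟩
  · convert isClopen_empty
    ext r
    simp [Character.map_zero]
  · convert ZHat.isClopen_dvd m n using 1
    ext r
    exact xi_proj r n m

lemma isClosedEmbedding_xi : Topology.IsClosedEmbedding xi :=
  continuous_xi.isClosedEmbedding xi_injective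

lemma xi_mem_maximal (r : ZHat) : xi r ∈ Character.maximal TZ := fun _ hy =>
  (eq_xi fun n m h => hy _ ((xi_proj r n m).2 h)).symm

/-- The support of every character is contained in the support of some `ξ_r`. -/
lemma exists_xi_ge (x : Character TZ) : ∃ r, ∀ e, x e = true → xi r e = true := by
  obtain ⟨e₀, he₀⟩ := x.nonzero
  have : Nonempty {e : Proj TZ // x e = true} := ⟨⟨e₀, he₀⟩⟩
  have hcl (e : {e : Proj TZ // x e = true}) : IsClosed {r : ZHat | xi r e = true} :=
    (isClosed_discrete {true}).preimage ((Character.continuous_eval e.1).comp continuous_xi)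
  have hdir : Directed (fun s t : Set ZHat => s ⊇ t)
      fun e : {e : Proj TZ // x e = true} => {r : ZHat | xi r e = true} := by
    rintro ⟨e, he⟩ ⟨f, hf⟩
    refine ⟨⟨e * f, by rw [Character.map_mul, he, hf]; rfl⟩, fun r hr => ?_, fun r hr => ?_⟩
    all_goals
      have hr' : xi r (e * f) = true := hr
      rw [Character.map_mul, Bool.and_eq_true] at hr'
    · exact hr'.1
    · exact hr'.2
  have hne (e : {e : Proj TZ // x e = true}) : {r : ZHat | xi r e = true}.Nonempty := by
    rcases e with ⟨e, he⟩
    rcases UZ.gen.eq_zero_or_eq_proj e with rfl | ⟨n, m, rfl⟩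
    · exact absurd rfl (ne_zero_of_apply he)
    · exact ⟨n, (xi_proj _ _ _).2 (by simp)⟩
  -- The support is closed under products, so these closed nonempty sets are directed, and a point
  -- of their intersection is the required `r`.
  obtain ⟨r, hr⟩ := IsCompact.nonempty_iInter_of_directed_nonempty_isCompact_isClosed
    _ hdir hne (fun e => (hcl e).isCompact) hcl
  exact ⟨r, fun e he => Set.mem_iInter.1 hr ⟨e, he⟩⟩

/-- A maximal character lies below some `ξ_r` and hence equals it; the set of all `ξ_r` is already
closed, so the closure adds nothing. -/
lemma tight_eq_range : Character.tight TZ = Set.range xi := by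
  refine subset_antisymm (closure_minimal (fun x hx => ?_) isClosedEmbedding_xi.isClosed_range) ?_
  · obtain ⟨r, hr⟩ := exists_xi_ge x
    exact ⟨r, (hx _ hr).symm⟩
  · rintro _ ⟨r, rfl⟩
    exact subset_closure (xi_mem_maximal r)

/-- The homeomorphism `r ↦ ξ_r` of `ℤ̂` onto the tight spectrum of `T`. -/
def xiHomeo : ZHat ≃ₜ Character.tight TZ :=
  isClosedEmbedding_xi.isEmbedding.toHomeomorph.trans (Homeomorph.setCongr tight_eq_range.symm)

lemma coe_xiHomeo (r : ZHat) : (xiHomeo r : Character TZ) = xi r := rfl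

/-- The inclusion of `ℤ̂` as a homeomorphism onto `zhatSet`. -/
def inclHomeo : ZHat ≃ₜ zhatSet := RLim.isEmbedding_incl.toHomeomorph

/-- The homeomorphism of the unit spaces. -/
def unitsHomeo : zhatSet ≃ₜ Character.tight TZ := inclHomeo.symm.trans xiHomeo

/-! ### Topological groupoids -/

namespace ArrowGroupoid

variable {X G Y H : Type*} [TopologicalSpace X] [TopologicalSpace G] [TopologicalSpace Y]
  [TopologicalSpace H]

lemma IsTopological.restrict {𝒢 : ArrowGroupoid X G} (h : 𝒢.IsTopological) (Z : Set X) :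
    (𝒢.restrict Z).IsTopological where
  continuous_rng := (h.continuous_rng.comp continuous_subtype_val).subtype_mk _
  continuous_src := (h.continuous_src.comp continuous_subtype_val).subtype_mk _
  continuous_unit := (h.continuous_unit.comp continuous_subtype_val).subtype_mk _
  continuous_inv := (h.continuous_inv.comp continuous_subtype_val).subtype_mk _
  continuous_mul := by
    refine Continuous.subtype_mk (h.continuous_mul.comp (f := fun c : {c : _ × _ //
      (𝒢.restrict Z).src c.1 = (𝒢.restrict Z).rng c.2} =>
        ⟨(c.1.1.1, c.1.2.1), congrArg Subtype.val c.2⟩) ?_) _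
    exact Continuous.subtype_mk (by fun_prop) _

/-- This spares a direct verification that multiplication and inversion of tight germs are
continuous. -/
lemma TopIso.isTopological {𝒢 : ArrowGroupoid X G} {ℋ : ArrowGroupoid Y H} (φ : 𝒢.TopIso ℋ)
    (h : 𝒢.IsTopological) : ℋ.IsTopological where
  continuous_rng := by
    convert φ.units.continuous.comp (h.continuous_rng.comp φ.arrows.symm.continuous) using 1
    funext a
    simp [← φ.map_rng]
  continuous_src := by
    convert φ.units.continuous.comp (h.continuous_src.comp φ.arrows.symm.continuous) using 1
    funext a
    simp [← φ.map_src]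
  continuous_unit := by
    convert φ.arrows.continuous.comp (h.continuous_unit.comp φ.units.symm.continuous) using 1
    funext a
    simp [φ.map_unit]
  continuous_inv := by
    convert φ.arrows.continuous.comp (h.continuous_inv.comp φ.arrows.symm.continuous) using 1
    funext a
    simp [φ.map_inv]
  continuous_mul := by
    have hc (c : {c : H × H // ℋ.src c.1 = ℋ.rng c.2}) :
        𝒢.src (φ.arrows.symm c.1.1) = 𝒢.rng (φ.arrows.symm c.1.2) := by
      apply φ.units.injective
      rw [← φ.map_src, ← φ.map_rng, Homeomorph.apply_symm_apply, Homeomorph.apply_symm_apply, c.2]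
    have h1 := φ.arrows.continuous.comp (h.continuous_mul.comp
      (f := fun c : {c : H × H // ℋ.src c.1 = ℋ.rng c.2} =>
        ⟨(φ.arrows.symm c.1.1, φ.arrows.symm c.1.2), hc c⟩) (Continuous.subtype_mk (by fun_prop) _))
    convert h1 using 1
    funext c
    simp [φ.map_mul]

end ArrowGroupoid

lemma isTopological_transformationGroupoid (X Γ : Type*) [Group Γ] [MulAction Γ X]
    [TopologicalSpace X] [TopologicalSpace Γ] [DiscreteTopology Γ] [ContinuousConstSMul Γ X] :
    (transformationGroupoid X Γ).IsTopological where
  continuous_rng := continuous_fst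
  continuous_src := continuous_prod_of_discrete_right.2 fun g => continuous_const_smul g⁻¹
  continuous_unit := by
    change Continuous fun x : X => (x, (1 : Γ))
    fun_prop
  continuous_inv := continuous_prod_of_discrete_right.2 fun g =>
    (continuous_const_smul g⁻¹).prodMk (continuous_const (y := g⁻¹))
  continuous_mul := by
    have h : Continuous fun c : Γ × Γ => c.1 * c.2 := continuous_of_discreteTopology
    change Continuous fun c : {c : (X × Γ) × (X × Γ) // _} => (c.1.1.1, c.1.1.2 * c.1.2.2)
    exact Continuous.prodMk (by fun_prop) (h.comp (f := fun c : {c : (X × Γ) × (X × Γ) // _} =>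
      (c.1.1.2, c.1.2.2)) (by fun_prop))

lemma isTopological_affineGroupoid : affineGroupoid.IsTopological :=
  (isTopological_transformationGroupoid RLim PQ).restrict zhatSet

/-! ### Germs -/

namespace Germ

variable {S : Type*} [SemigroupWithZero S] [StarMul S] [IsInverseSemigroup S]

lemma isOpen_slice (s : S) {U : Set (Character S)} (hU : IsOpen U)
    (h : ∀ x ∈ U, x (Proj.range s) = true) :
    IsOpen {γ : Germ S | ∃ x ∈ U, ∃ h, γ = mk x s h} :=
  TopologicalSpace.isOpen_generateFrom_of_mem ⟨s, U, hU, h, rfl⟩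

lemma exists_rep (γ : Germ S) : ∃ x s h, γ = mk x s h := by
  obtain ⟨⟨⟨x, s⟩, h⟩⟩ := γ
  exact ⟨x, s, h, rfl⟩

lemma continuous_rng : Continuous (rng : Germ S → Character S) := by
  refine ⟨fun V hV => isOpen_iff_forall_mem_open.2 fun γ hγ => ?_⟩
  obtain ⟨x, s, h, rfl⟩ := γ.exists_rep
  refine ⟨_, ?_, isOpen_slice s (hV.inter (Character.isOpen_eval (Proj.range s)))
    fun y hy => hy.2, x, ⟨hγ, h⟩, h, rfl⟩
  rintro _ ⟨y, hy, h', rfl⟩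
  exact hy.1

lemma mul_mk {x y : Character S} {s t : S} {a b : Germ S} {hs : x (Proj.range s) = true}
    {ht : y (Proj.range t) = true} (ha : a = mk x s hs) (hb : b = mk y t ht) (h : src a = rng b)
    (hst : x (Proj.range (s * t)) = true) : mul a b h = mk x (s * t) hst := by
  subst ha hb
  rfl

lemma inv_mk {x y : Character S} {s : S} {a : Germ S} {hs : x (Proj.range s) = true}
    (ha : a = mk x s hs) (hy : x.act s hs = y) (hs' : y (Proj.range (star s)) = true) :
    inv a = mk y (star s) hs' := by
  subst ha hy
  rfl

end Germ

open Character

/-! ### The elements of `T` given by matrices -/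

namespace PQ

/-- The element `s_m^* u^k s_n` of `T` for the matrix `[[1, 0], [k/m, n/m]]`. -/
def word (g : PQ) : TZ :=
  UZ.gen.word g.exists_frac.choose_spec.choose_spec.choose g.exists_frac.choose
    g.exists_frac.choose_spec.choose

/-- The chosen representative is immaterial: two fractions for one matrix have a common expansion,
to which `word_scale` applies. -/
lemma word_frac (k : ℤ) (n m : ℤ⁰) : (frac k n m).word = UZ.gen.word m k n := by
  have h := (frac k n m).exists_frac.choose_spec.choose_spec.choose_spec
  obtain ⟨h1, h2⟩ := (frac_eq_frac_iff _ _ _ _ _ _).1 h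
  rw [word]
  generalize (frac k n m).exists_frac.choose_spec.choose_spec.choose = m' at *
  generalize (frac k n m).exists_frac.choose_spec.choose = n' at *
  generalize (frac k n m).exists_frac.choose = k' at *
  rw [← UZ.gen.word_scale m m' k' n', ← UZ.gen.word_scale m' m k n, mul_comm m m',
    mul_comm (m : ℤ), h1, mul_comm m n', h2, mul_comm k, mul_comm n]

lemma word_one : (word 1 : UZ) = 1 := by
  rw [← frac_one, word_frac, Family.word_one]

lemma word_mul (g h : PQ) : g.word * h.word = (Proj.range g.word).1 * (g * h).word := by
  obtain ⟨k, n, m, rfl⟩ := g.exists_frac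
  obtain ⟨k', n', m', rfl⟩ := h.exists_frac
  rw [frac_mul_frac, word_frac, word_frac, word_frac, Family.word_mul_word]

lemma star_word (g : PQ) : star g.word = g⁻¹.word := by
  obtain ⟨k, n, m, rfl⟩ := g.exists_frac
  rw [frac_inv, word_frac, word_frac, Family.star_word]

lemma eq_of_proj_mul_word {g h : PQ} {e : Proj TZ} (he : e ≠ 0)
    (hg : e * Proj.range g.word = e) (hgh : e.1 * g.word = e.1 * h.word) : g = h := by
  obtain ⟨k, n, m, rfl⟩ := g.exists_frac
  obtain ⟨k', n', m', rfl⟩ := h.exists_frac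
  obtain ⟨a, b, rfl⟩ := (UZ.gen.eq_zero_or_eq_proj e).resolve_left he
  rw [word_frac] at hg
  rw [word_frac, word_frac] at hgh
  obtain ⟨h1, h2⟩ := UZ.frac_eq_of_p_mul_word (congrArg (fun t : TZ => (t : UZ)) hgh)
    (congrArg (fun e : Proj TZ => (e.1 : UZ)) hg)
  exact ext (by rw [b_frac, b_frac, h1]) (by rw [a_frac, a_frac, h2])

lemma xi_range_word {g : PQ} {r r' : ZHat} (h : RLim.incl r = g • RLim.incl r') :
    xi r (Proj.range g.word) = true := by
  obtain ⟨k, n, m, rfl⟩ := g.exists_frac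
  rw [word_frac]
  exact CuntzLi.xi_range_word ((incl_eq_frac_smul_iff _ _ _ _ _).1 h)

lemma exists_of_xi_range_word {g : PQ} {r : ZHat} (h : xi r (Proj.range g.word) = true) :
    ∃ r', RLim.incl r = g • RLim.incl r' := by
  obtain ⟨k, n, m, rfl⟩ := g.exists_frac
  rw [word_frac] at h
  obtain ⟨r', hr'⟩ := CuntzLi.exists_of_xi_range_word h
  exact ⟨r', (incl_eq_frac_smul_iff _ _ _ _ _).2 hr'⟩

lemma act_word {g : PQ} {r r' : ZHat} (h : RLim.incl r = g • RLim.incl r')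
    (hw : xi r (Proj.range g.word) = true) : (xi r).act g.word hw = xi r' := by
  obtain ⟨k, n, m, rfl⟩ := g.exists_frac
  have h1 := act_xi_word ((incl_eq_frac_smul_iff _ _ _ _ _).1 h) (by rwa [← word_frac])
  rw [← h1]
  congr 1
  exact word_frac k n m

end PQ

lemma Germ.eq_of_mk_word_eq {x y : Character TZ} {g h : PQ} {hg : x (Proj.range g.word) = true}
    {hh : y (Proj.range h.word) = true} (hgh : Germ.mk x g.word hg = Germ.mk y h.word hh) :
    x = y ∧ g = h := by
  obtain ⟨hxy, e, he, heq⟩ := Quotient.exact hgh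
  refine ⟨hxy, ?_⟩
  change x e = true at he
  change (e : TZ) * g.word = e * h.word at heq
  -- Shrinking `e` by the range of `g.word` gives a projection below that range, which is nonzero
  -- because `x` is `1` on it.
  have hx : x (Proj.range g.word * e) = true := by rw [Character.map_mul, hg, he]; rfl
  refine PQ.eq_of_proj_mul_word (ne_zero_of_apply hx) ?_ ?_
  · rw [mul_right_comm, Proj.mul_self]
  · rw [Proj.coe_mul, mul_assoc, heq, mul_assoc]

/-- Write `t = q w` with a word `w`. The range of `t` is `q` times that of `w`, so `x` is `1` on
`q`, and `q` itself witnesses that `t` and `w` have the same germ. -/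
lemma Germ.exists_eq_mk_word (x : Character TZ) (t : TZ) (h : x (Proj.range t) = true) :
    ∃ (g : PQ) (hg : x (Proj.range g.word) = true), Germ.mk x t h = Germ.mk x g.word hg := by
  obtain ⟨q, m, k, n, rfl⟩ := UZ.gen.exists_eq_proj_mul_word t
  generalize hw : UZ.gen.word m k n = w at h ⊢
  rw [← PQ.word_frac] at hw
  subst hw
  have h1 : Proj.range (q.1 * (PQ.frac k n m).word) = q * Proj.range (PQ.frac k n m).word := by
    rw [← Proj.conj_range, Proj.conj_proj]
  have h2 := h
  rw [h1, Character.map_mul, Bool.and_eq_true] at h2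
  exact ⟨_, h2.2, Germ.sound h h2.2 q h2.1 (by rw [← mul_assoc, q.sq])⟩

/-! ### The isomorphism -/

namespace AffineArrow

lemma exists_rep (γ : AffineArrow) : ∃ (r r' : ZHat) (g : PQ), γ.1 = (RLim.incl r, g) ∧
    RLim.incl r = g • RLim.incl r' := by
  obtain ⟨⟨c, g⟩, ⟨r, hr⟩, ⟨r', hr'⟩⟩ := γ
  obtain rfl : RLim.incl r = c := hr
  refine ⟨r, r', g, rfl, ?_⟩
  rw [hr']
  exact (smul_inv_smul _ _).symm

/-- The range `r ∈ ℤ̂` of an arrow. -/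
def base (γ : AffineArrow) : ZHat := inclHomeo.symm (affineGroupoid.rng γ)

lemma continuous_base : Continuous base :=
  inclHomeo.symm.continuous.comp isTopological_affineGroupoid.continuous_rng

lemma base_eq {γ : AffineArrow} {r : ZHat} {g : PQ} (h : γ.1 = (RLim.incl r, g)) :
    base γ = r := by
  rw [base, Homeomorph.symm_apply_eq]
  exact Subtype.ext (congrArg Prod.fst h)

lemma xi_base_range (γ : AffineArrow) : xi (base γ) (Proj.range γ.1.2.word) = true := by
  obtain ⟨r, r', g, h, h'⟩ := γ.exists_rep
  rw [base_eq h, h]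
  exact PQ.xi_range_word h'

/-- The germ `[ξ_r, s_m^* u^k s_n]` of the arrow `(r, [[1, 0], [k/m, n/m]])`. -/
def toGerm (γ : AffineArrow) : Germ TZ := Germ.mk (xi (base γ)) γ.1.2.word γ.xi_base_range

lemma toGerm_eq {γ : AffineArrow} {r : ZHat} {g : PQ} (h : γ.1 = (RLim.incl r, g))
    (hw : xi r (Proj.range g.word) = true) : toGerm γ = Germ.mk (xi r) g.word hw := by
  obtain rfl := base_eq h
  have hg : γ.1.2 = g := congrArg Prod.snd h
  subst hg
  rfl

lemma rng_toGerm (γ : AffineArrow) :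
    Germ.rng (toGerm γ) = unitsHomeo (affineGroupoid.rng γ) := rfl

lemma src_toGerm (γ : AffineArrow) :
    Germ.src (toGerm γ) = unitsHomeo (affineGroupoid.src γ) := by
  obtain ⟨r, r', g, h, h'⟩ := γ.exists_rep
  have h1 : affineGroupoid.src γ = inclHomeo r' := by
    refine Subtype.ext ?_
    change γ.1.2⁻¹ • γ.1.1 = RLim.incl r'
    rw [h, h', inv_smul_smul]
  rw [toGerm_eq h (PQ.xi_range_word h'), h1]
  change (xi r).act g.word (PQ.xi_range_word h') = xiHomeo (inclHomeo.symm (inclHomeo r'))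
  rw [Homeomorph.symm_apply_apply, PQ.act_word h', coe_xiHomeo]

/-- The arrow of the tight groupoid given by an arrow of `(𝓡 × P_ℚ)|_ℤ̂`. -/
def toTight (γ : AffineArrow) : TightArrow TZ :=
  ⟨toGerm γ, (unitsHomeo (affineGroupoid.rng γ)).2, by
    change Germ.src (toGerm γ) ∈ _
    rw [src_toGerm]
    exact (unitsHomeo _).2⟩

lemma toTight_injective : Function.Injective toTight := by
  intro γ γ' h
  obtain ⟨r, r', g, hr, hg⟩ := γ.exists_rep
  obtain ⟨t, t', g', ht, hg'⟩ := γ'.exists_rep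
  have h1 : toGerm γ = toGerm γ' := congrArg Subtype.val h
  rw [toGerm_eq hr (PQ.xi_range_word hg), toGerm_eq ht (PQ.xi_range_word hg')] at h1
  obtain ⟨h2, rfl⟩ := Germ.eq_of_mk_word_eq h1
  obtain rfl := xi_injective h2
  exact Subtype.ext (hr.trans ht.symm)

lemma toTight_surjective : Function.Surjective toTight := by
  rintro ⟨δ, hδ⟩
  obtain ⟨x, t, h, rfl⟩ := δ.exists_rep
  have hx : x ∈ Set.range xi := tight_eq_range ▸ hδ.1
  obtain ⟨r, rfl⟩ := hx
  obtain ⟨g, hg, hgt⟩ := Germ.exists_eq_mk_word (xi r) t h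
  -- That `ξ_r` lies in the domain of the word means that the source of `(r, g)` is again in `ℤ̂`,
  -- so the pair is an arrow of the reduction.
  obtain ⟨r', hr'⟩ := PQ.exists_of_xi_range_word hg
  refine ⟨⟨(RLim.incl r, g), ⟨r, rfl⟩, ⟨r', ?_⟩⟩, Subtype.ext ((toGerm_eq rfl hg).trans hgt.symm)⟩
  exact eq_inv_smul_iff.2 hr'.symm

lemma continuous_toGerm : Continuous toGerm := by
  refine continuous_generateFrom_iff.2 ?_
  rintro _ ⟨s, U, hU, -, rfl⟩
  refine isOpen_iff_forall_mem_open.2 fun γ hγ => ?_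
  obtain ⟨x, hx, hs, heq⟩ := hγ
  obtain ⟨hxx, e, he, hes⟩ := Quotient.exact heq
  obtain rfl : xi (base γ) = x := hxx
  change xi (base γ) e = true at he
  change (e : TZ) * γ.1.2.word = e * s at hes
  have hxi : Continuous fun β : AffineArrow => xi (base β) := continuous_xi.comp continuous_base
  have hsnd : Continuous fun β : AffineArrow => β.1.2 := continuous_snd.comp continuous_subtype_val
  -- On nearby arrows the matrix is the same and the characters are still `1` on `e`, so the same
  -- `e` identifies their germs with germs of `s`.
  refine ⟨{β | xi (base β) ∈ U ∩ {y | y e = true} ∩ {y | y (Proj.range s) = true}} ∩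
    {β | β.1.2 ∈ ({γ.1.2} : Set PQ)}, ?_, IsOpen.inter ?_ ?_, ⟨⟨⟨hx, he⟩, hs⟩, rfl⟩⟩
  · rintro β ⟨⟨⟨hβU, hβe⟩, hβs⟩, hβ⟩
    refine ⟨xi (base β), hβU, hβs, Germ.sound _ _ e hβe ?_⟩
    rw [Set.mem_singleton_iff.1 hβ, hes]
  · exact ((hU.inter (isOpen_eval e)).inter (isOpen_eval _)).preimage hxi
  · exact (isOpen_discrete _).preimage hsnd

/-- The bijection of the sets of arrows. -/
def equivTight : AffineArrow ≃ TightArrow TZ :=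
  Equiv.ofBijective toTight ⟨toTight_injective, toTight_surjective⟩

lemma continuous_equivTight_symm : Continuous equivTight.symm := by
  have hrng : Continuous fun δ : TightArrow TZ => ((tightGroupoid TZ).rng δ) :=
    (Germ.continuous_rng.comp continuous_subtype_val).subtype_mk _
  refine continuous_induced_rng.2 (Continuous.prodMk ?_ ?_)
  -- The point of `ℤ̂` is recovered from the range of the germ.
  · convert continuous_subtype_val.comp (unitsHomeo.symm.continuous.comp hrng) using 1
    funext δ
    obtain ⟨γ, rfl⟩ := equivTight.surjective δ
    rw [Function.comp_apply, Equiv.symm_apply_apply]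
    have h : (tightGroupoid TZ).rng (equivTight γ) = unitsHomeo (affineGroupoid.rng γ) := rfl
    rw [Function.comp_apply, h, Homeomorph.symm_apply_apply]
    rfl
  -- The matrix is constant on the open slice of germs of a single word, because the germ of a word
  -- determines its matrix.
  · refine IsLocallyConstant.continuous ((IsLocallyConstant.iff_exists_open _).2 fun δ => ?_)
    obtain ⟨γ, rfl⟩ := equivTight.surjective δ
    refine ⟨_, (Germ.isOpen_slice γ.1.2.word (isOpen_eval (Proj.range γ.1.2.word))
      fun _ hy => hy).preimage continuous_subtype_val,
      ⟨xi (base γ), γ.xi_base_range, γ.xi_base_range, rfl⟩, ?_⟩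
    rintro δ' ⟨y, hy, hy', h⟩
    obtain ⟨γ', rfl⟩ := equivTight.surjective δ'
    simp only [Equiv.symm_apply_apply]
    exact (Germ.eq_of_mk_word_eq h).2

/-- The homeomorphism of the spaces of arrows. -/
def homeoTight : AffineArrow ≃ₜ TightArrow TZ where
  toEquiv := equivTight
  continuous_toFun := continuous_toGerm.subtype_mk _
  continuous_invFun := continuous_equivTight_symm

lemma toGerm_unit (c : zhatSet) :
    toGerm (affineGroupoid.unit c) = Germ.unit (unitsHomeo c : Character TZ) := by
  obtain ⟨r, rfl⟩ := inclHomeo.surjective c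
  have h : RLim.incl r = (1 : PQ) • RLim.incl r := (one_smul _ _).symm
  have he : xi r (Proj.range (PQ.word 1)) = true := PQ.xi_range_word h
  rw [toGerm_eq (γ := affineGroupoid.unit (inclHomeo r)) rfl he]
  have hu : (unitsHomeo (inclHomeo r) : Character TZ) = xi r := by
    rw [unitsHomeo, Homeomorph.trans_apply, Homeomorph.symm_apply_apply, coe_xiHomeo]
  -- The word of the identity matrix is `1`, a projection, so its germ is a unit.
  have hp : ((Proj.range (PQ.word 1)).1 : TZ) = PQ.word 1 := by
    refine Subtype.ext ?_
    rw [Family.coe_range, PQ.word_one, star_one, mul_one]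
  rw [hu, Germ.unit_eq _ _ he]
  congr 1
  exact hp.symm

lemma toGerm_mul (α β : AffineArrow) (h : affineGroupoid.src α = affineGroupoid.rng β)
    (h' : Germ.src (toGerm α) = Germ.rng (toGerm β)) :
    toGerm (affineGroupoid.mul α β h) = Germ.mul (toGerm α) (toGerm β) h' := by
  have hαβ : xi (base α) (Proj.range (α.1.2.word * β.1.2.word)) = true :=
    Germ.range_mul α.xi_base_range (by
      have h1 : (xi (base α)).act α.1.2.word α.xi_base_range = xi (base β) := h'
      rw [h1]
      exact β.xi_base_range)
  refine Eq.trans ?_ (Germ.mul_mk rfl rfl h' hαβ).symm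
  -- The word of the product and the product of the words agree below the range of the first word,
  -- where `ξ_r` is `1`.
  refine Germ.sound _ _ (Proj.range α.1.2.word) α.xi_base_range ?_
  rw [PQ.word_mul, ← mul_assoc, Proj.sq]
  rfl

lemma toGerm_inv (α : AffineArrow) : toGerm (affineGroupoid.inv α) = Germ.inv (toGerm α) := by
  obtain ⟨r, r', g, hr, hg⟩ := α.exists_rep
  have hg' : RLim.incl r' = g⁻¹ • RLim.incl r := eq_inv_smul_iff.2 hg.symm
  have h1 : (affineGroupoid.inv α).1 = (RLim.incl r', g⁻¹) := by
    change (α.1.2⁻¹ • α.1.1, α.1.2⁻¹) = _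
    rw [hr, hg']
  have hw := PQ.xi_range_word hg'
  rw [toGerm_eq h1 hw, Germ.inv_mk (toGerm_eq hr (PQ.xi_range_word hg)) (PQ.act_word hg _)
    (by rw [PQ.star_word]; exact hw)]
  congr 1
  exact (PQ.star_word g).symm

/-- The isomorphism `(𝓡 × P_ℚ)|_ℤ̂ ≅ 𝒢_tight`. -/
def topIso : affineGroupoid.TopIso (tightGroupoid TZ) where
  arrows := homeoTight
  units := unitsHomeo
  map_rng γ := Subtype.ext (rng_toGerm γ)
  map_src γ := Subtype.ext (src_toGerm γ)
  map_unit c := Subtype.ext (toGerm_unit c)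
  map_mul α β h := Subtype.ext (toGerm_mul α β h (by
    rw [src_toGerm, rng_toGerm, h]))
  map_inv α := Subtype.ext (toGerm_inv α)

end AffineArrow

end CuntzLi

end

theorem mainTheorem1 :
    affineGroupoid.IsTopological ∧ (tightGroupoid TZ).IsTopological ∧
    ∃ φ : affineGroupoid.TopIso (tightGroupoid TZ),
      ∀ (r : ZHat) (k : ℤ) (m n : ℤ⁰) (γ : AffineArrow),
        γ.1 = (RLim.incl r, PQ.frac k n m) →
          ∃ (ξ : Character TZ) (hξ : ξ (Proj.range (UZ.gen.word m k n)) = true),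
            IsXi r ξ ∧ (φ.arrows γ).1 = Germ.mk ξ (UZ.gen.word m k n) hξ := by
  refine ⟨isTopological_affineGroupoid,
    AffineArrow.topIso.isTopological isTopological_affineGroupoid, AffineArrow.topIso, ?_⟩
  intro r k m n γ h
  have hr : xi r (Proj.range (PQ.frac k n m).word) = true := by
    have h1 := γ.xi_base_range
    rwa [AffineArrow.base_eq h, h] at h1
  have hγ : (AffineArrow.topIso.arrows γ).1 = Germ.mk (xi r) (PQ.frac k n m).word hr :=
    AffineArrow.toGerm_eq h hr
  -- The isomorphism uses a chosen representative of the matrix; passing to the given `k`, `m`, `n`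
  -- shows that the formula holds for every representative.
  have hw := PQ.word_frac k n m
  refine ⟨xi r, hw ▸ hr, isXi_xi r, hγ.trans ?_⟩
  congr 1
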